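/- Let $n\ge 1$ and $\lambda_1,\dots,\lambda_n>0$. On $H_{n+1}=\mathbb C^n\times\mathbb R$, with points $x=(z,x_{2n+1})$, $y=(w,y_{2n+1})$ and $z_j=x_{2j-1}+ix_{2j}$, consider the CR structure $T^{1,0}H_{n+1}$ spanned by $Z_j=\frac{\partial}{\partial z_j}-i\lambda_j\overline z_j\frac{\partial}{\partial x_{2n+1}}$, $j=1,\dots,n$. Let $d\mu=2^n\,dx_1\cdots dx_{2n+1}$, the volume of the Hermitian metric for which $Z_j,\overline Z_j$ $(1\le j\le n)$ and $\frac{\partial}{\partial x_{2n+1}}$ are orthonormal, and let $L^2(H_{n+1})$ and $L^2_{(0,1)}(H_{n+1})$ be the corresponding $L^2$ spaces of functions and of $(0,1)$-forms $\sum_j v_j\,d\overline z_j$, with $\|\sum_j v_j\,d\overline z_j\|^2=\sum_j\int|v_j|^2\,d\mu$. Let $\overline\partial_b u=\sum_j(\overline Z_ju)\,d\overline z_j$ in the sense of distributions, with domain the set of all $u\in L^2(H_{n+1})$ such that $\overline\partial_bu\in L^2_{(0,1)}(H_{n+1})$, let $\overline\partial_b^{*}$ be its Hilbert space adjoint, and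 let $\Box_b^{(0)}=\overline\partial_b^{*}\overline\partial_b$ with domain $\{u\in\operatorname{Dom}\overline\partial_b:\overline\partial_bu\in\operatorname{Dom}\overline\partial_b^{*}\}$. The Szegő projection $S^{(0)}:L^2(H_{n+1})\to\operatorname{Ker}\Box_b^{(0)}$ is the orthogonal projection onto $\operatorname{Ker}\Box_b^{(0)}$. Put $$\varphi_-(x,y)=-x_{2n+1}+y_{2n+1}+i\sum_{j=1}^n|\lambda_j||z_j-w_j|^2+i\sum_{j=1}^n\lambda_j(\overline z_jw_j-z_j\overline w_j).$$ Then, for every $u\in C_c^\infty(H_{n+1})$ and every $x\in H_{n+1}$, the limit $$(I^{(0)}_{\varphi_-}u)(x)=\lim_{\varepsilon\to0^+}\int_{H_{n+1}}\frac{u(y)}{\bigl(-i(\varphi_-(x,y)+i\varepsilon)\bigr)^{n+1}}\,d\mu(y)$$ exists, the operator $I^{(0)}_{\varphi_-}$ extends uniquely to a bounded operator on $L^2(H_{n+1})$, and, writing $I^{(0)}_{\varphi_-}$ also for this extension, $$S^{(0)}=\frac{|\lambda_1|\cdots|\lambda_n|}{2\pi^{n+1}}\,n!\;I^{(0)}_{\varphi_-}\quad\text{on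 }L^2(H_{n+1}).$$ -/

import Mathlib

open MeasureTheory Filter Topology
open scoped NNReal ENNReal ContDiff ComplexConjugate InnerProductSpace

noncomputable section

namespace Heisenberg

/-- The space `ℂⁿ × ℝ` with coordinates `x = (z, t)`, `t = x_{2n+1}`. -/
abbrev Heis (n : ℕ) : Type := (Fin n → ℂ) × ℝ

/-- The volume `2ⁿ dx₁ ⋯ dx_{2n+1}`, induced by the metric in which `Z_j, Z̄_j, T` are orthonormal. -/
abbrev heisVol (n : ℕ) : Measure (Heis n) := (2 ^ n : ℝ≥0) • (volume : Measure (Heis n))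

/-- `L²(H_{n+1})`. -/
abbrev L2Fun (n : ℕ) : Type := Lp ℂ 2 (heisVol n)

/-- `L²_{(0,1)}(H_{n+1})`; a `(0,1)`-form `∑ v_j dz̄_j` is given by its coefficients `v_j` in the
orthonormal frame `dz̄_1, …, dz̄_n`. -/
abbrev L2Form (n : ℕ) : Type := Lp (EuclideanSpace ℂ (Fin n)) 2 (heisVol n)

/-- `u ∈ C_c^∞(H_{n+1})`. -/
def IsTest {n : ℕ} (u : Heis n → ℂ) : Prop := ContDiff ℝ ∞ u ∧ HasCompactSupport u

/-- `∂f/∂z̄_j = ½ (∂f/∂x_{2j-1} + i ∂f/∂x_{2j})`. -/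
def dzbar {n : ℕ} (j : Fin n) (f : Heis n → ℂ) (x : Heis n) : ℂ :=
  (1 / 2) * (fderiv ℝ f x (Pi.single j 1, 0) + Complex.I * fderiv ℝ f x (Pi.single j Complex.I, 0))

/-- `∂f/∂x_{2n+1}`. -/
def dt {n : ℕ} (f : Heis n → ℂ) (x : Heis n) : ℂ := fderiv ℝ f x (0, 1)

/-- The vector field `Z̄_j = ∂/∂z̄_j + i λ_j z_j ∂/∂x_{2n+1}`. -/
def Zbar {n : ℕ} (lam : Fin n → ℝ) (j : Fin n) (f : Heis n → ℂ) (x : Heis n) : ℂ :=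
  dzbar j f x + Complex.I * lam j * x.1 j * dt f x

/-- `∂̄_b u = ∑ v_j dz̄_j` in the sense of distributions, i.e. `Z̄_j u = v_j` weakly for all `j`.
The coefficient of `∂/∂x_{2n+1}` in `Z̄_j` does not depend on `x_{2n+1}`, so the transpose of `Z̄_j`
is `-Z̄_j`. -/
def IsWeakDbar {n : ℕ} (lam : Fin n → ℝ) (u : Heis n → ℂ)
    (v : Heis n → EuclideanSpace ℂ (Fin n)) : Prop :=
  ∀ (j : Fin n) (φ : Heis n → ℂ), IsTest φ →
    ∫ x, v x j * φ x ∂(heisVol n) = -∫ x, u x * Zbar lam j φ x ∂(heisVol n)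

section helpers

variable {n : ℕ}

theorem IsTest.memLp {u : Heis n → ℂ} (hu : IsTest u) : MemLp u 2 (heisVol n) :=
  hu.1.continuous.memLp_of_hasCompactSupport hu.2

theorem IsTest.fderiv_apply {u : Heis n → ℂ} (hu : IsTest u) (e : Heis n) :
    IsTest (fun x => fderiv ℝ u x e) :=
  ⟨(hu.1.fderiv_right (by simp)).clm_apply contDiff_const, hu.2.fderiv_apply (𝕜 := ℝ) e⟩

theorem contDiff_coord (j : Fin n) : ContDiff ℝ ∞ (fun x : Heis n => x.1 j) :=
  (contDiff_apply ℝ ℂ j).comp contDiff_fst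

theorem IsTest.mul_left {u : Heis n → ℂ} (hu : IsTest u) {g : Heis n → ℂ} (hg : ContDiff ℝ ∞ g) :
    IsTest (fun x => g x * u x) :=
  ⟨hg.mul hu.1, hu.2.mul_left⟩

theorem IsTest.add {u v : Heis n → ℂ} (hu : IsTest u) (hv : IsTest v) :
    IsTest (fun x => u x + v x) :=
  ⟨hu.1.add hv.1, hu.2.add hv.2⟩

theorem IsTest.zbar {u : Heis n → ℂ} (hu : IsTest u) (lam : Fin n → ℝ) (j : Fin n) :
    IsTest (Zbar lam j u) :=
  (((hu.fderiv_apply _).add ((hu.fderiv_apply _).mul_left contDiff_const)).mul_left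
    contDiff_const).add
    ((hu.fderiv_apply _).mul_left ((contDiff_const.mul contDiff_const).mul (contDiff_coord j)))

theorem integrable_mul_test {u φ : Heis n → ℂ} (hu : MemLp u 2 (heisVol n)) (hφ : IsTest φ) :
    Integrable (fun x => u x * φ x) (heisVol n) :=
  hu.integrable_mul hφ.memLp

theorem memLp_coord {v : Heis n → EuclideanSpace ℂ (Fin n)} (hv : MemLp v 2 (heisVol n))
    (j : Fin n) : MemLp (fun x => v x j) 2 (heisVol n) :=
  (EuclideanSpace.proj (𝕜 := ℂ) j).comp_memLp' hv

theorem integral_fderiv_mul {u φ : Heis n → ℂ} (hu : IsTest u) (hφ : IsTest φ) (e : Heis n) :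
    ∫ x, fderiv ℝ u x e * φ x ∂(heisVol n) = -∫ x, u x * fderiv ℝ φ x e ∂(heisVol n) := by
  have hint : ∀ {f g : Heis n → ℂ}, IsTest f → IsTest g →
      Integrable (fun x => f x * g x) (volume : Measure (Heis n)) := fun hf hg =>
    (hf.1.continuous.mul hg.1.continuous).integrable_of_hasCompactSupport hg.2.mul_left
  have : (volume : Measure (Fin n → ℂ)).IsAddHaarMeasure := Measure.pi.isAddHaarMeasure _
  have : (volume : Measure (Heis n)).IsAddHaarMeasure :=
    inferInstanceAs (((volume : Measure (Fin n → ℂ)).prod (volume : Measure ℝ)).IsAddHaarMeasure)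
  have h := integral_mul_fderiv_eq_neg_fderiv_mul_of_integrable (v := e)
    (μ := (volume : Measure (Heis n))) (hint (hu.fderiv_apply e) hφ) (hint hu (hφ.fderiv_apply e))
    (hint hu hφ) (fun x _ => (hu.1.differentiable (by simp)).differentiableAt)
    (fun x _ => (hφ.1.differentiable (by simp)).differentiableAt)
  rw [integral_smul_nnreal_measure, integral_smul_nnreal_measure, h, smul_neg, neg_neg]

theorem dt_coord_mul {φ : Heis n → ℂ} (hφ : IsTest φ) (j : Fin n) (x : Heis n) :
    fderiv ℝ (fun y : Heis n => y.1 j * φ y) x (0, 1) = x.1 j * fderiv ℝ φ x (0, 1) := by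
  let L : Heis n →L[ℝ] ℂ :=
    (ContinuousLinearMap.proj (R := ℝ) (φ := fun _ : Fin n => ℂ) j).comp
      (ContinuousLinearMap.fst ℝ (Fin n → ℂ) ℝ)
  have h := (L.hasFDerivAt (x := x)).mul
    ((hφ.1.differentiable (by simp)).differentiableAt (x := x)).hasFDerivAt
  have h2 : fderiv ℝ (fun y : Heis n => y.1 j * φ y) x = _ := h.fderiv
  rw [h2]
  simp [L]

/-- For test functions the pointwise `Z̄_j u` is the distributional one. -/
theorem integral_zbar_mul (lam : Fin n → ℝ) (j : Fin n) {u φ : Heis n → ℂ} (hu : IsTest u)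
    (hφ : IsTest φ) :
    ∫ x, Zbar lam j u x * φ x ∂(heisVol n) = -∫ x, u x * Zbar lam j φ x ∂(heisVol n) := by
  have h1 := integral_fderiv_mul hu hφ (Pi.single j 1, 0)
  have h2 := integral_fderiv_mul hu hφ (Pi.single j Complex.I, 0)
  have h3 := integral_fderiv_mul hu (hφ.mul_left (contDiff_coord j)) (0, 1)
  simp only [dt_coord_mul hφ] at h3
  have i1 : ∀ e, Integrable (fun x => fderiv ℝ u x e * φ x) (heisVol n) := fun e =>
    integrable_mul_test (hu.fderiv_apply e).memLp hφ
  have i2 : ∀ e, Integrable (fun x => u x * fderiv ℝ φ x e) (heisVol n) := fun e =>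
    integrable_mul_test hu.memLp (hφ.fderiv_apply e)
  have i3 : Integrable (fun x => fderiv ℝ u x (0, 1) * (x.1 j * φ x)) (heisVol n) :=
    integrable_mul_test (hu.fderiv_apply _).memLp (hφ.mul_left (contDiff_coord j))
  have i4 : Integrable (fun x => u x * (x.1 j * fderiv ℝ φ x (0, 1))) (heisVol n) :=
    integrable_mul_test hu.memLp ((hφ.fderiv_apply _).mul_left (contDiff_coord j))
  have e1 : ∀ x, Zbar lam j u x * φ x =
      (1 / 2) * (fderiv ℝ u x (Pi.single j 1, 0) * φ x)
        + (1 / 2 * Complex.I) * (fderiv ℝ u x (Pi.single j Complex.I, 0) * φ x)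
        + (Complex.I * lam j) * (fderiv ℝ u x (0, 1) * (x.1 j * φ x)) := by
    intro x; simp only [Zbar, dzbar, dt]; ring
  have e2 : ∀ x, u x * Zbar lam j φ x =
      (1 / 2) * (u x * fderiv ℝ φ x (Pi.single j 1, 0))
        + (1 / 2 * Complex.I) * (u x * fderiv ℝ φ x (Pi.single j Complex.I, 0))
        + (Complex.I * lam j) * (u x * (x.1 j * fderiv ℝ φ x (0, 1))) := by
    intro x; simp only [Zbar, dzbar, dt]; ring
  simp only [e1, e2]
  have key : ∀ {f g h : Heis n → ℂ} (a b c : ℂ), Integrable f (heisVol n) →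
      Integrable g (heisVol n) → Integrable h (heisVol n) →
      ∫ x, (a * f x + b * g x + c * h x) ∂(heisVol n) =
        a * ∫ x, f x ∂(heisVol n) + b * ∫ x, g x ∂(heisVol n) + c * ∫ x, h x ∂(heisVol n) := by
    intro f g h a b c hf hg hh
    have s1 : Integrable (fun x => a * f x + b * g x) (heisVol n) :=
      (hf.const_mul a).add (hg.const_mul b)
    rw [integral_add s1 (hh.const_mul c), integral_add (hf.const_mul a) (hg.const_mul b)]
    simp only [integral_const_mul]
  rw [key _ _ _ (i1 _) (i1 _) i3, key _ _ _ (i2 _) (i2 _) i4, h1, h2, h3]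
  ring

theorem isWeakDbar_congr (lam : Fin n → ℝ) {u u' : Heis n → ℂ}
    {v v' : Heis n → EuclideanSpace ℂ (Fin n)} (hu : u =ᵐ[heisVol n] u')
    (hv : v =ᵐ[heisVol n] v') (h : IsWeakDbar lam u v) : IsWeakDbar lam u' v' := by
  intro j φ hφ
  have a := h j φ hφ
  have e1 : ∫ x, v x j * φ x ∂(heisVol n) = ∫ x, v' x j * φ x ∂(heisVol n) :=
    integral_congr_ae (hv.mono fun x hx => by simp only [hx])
  have e2 : ∫ x, u x * Zbar lam j φ x ∂(heisVol n) = ∫ x, u' x * Zbar lam j φ x ∂(heisVol n) :=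
    integral_congr_ae (hu.mono fun x hx => by simp only [hx])
  rw [← e1, ← e2, a]

end helpers

/-- The graph of `∂̄_b : Dom ∂̄_b ⊂ L²(H_{n+1}) → L²_{(0,1)}(H_{n+1})`. -/
def dbarGraph {n : ℕ} (lam : Fin n → ℝ) : Submodule ℂ (L2Fun n × L2Form n) where
  carrier := {p | IsWeakDbar lam p.1 p.2}
  zero_mem' := by
    refine isWeakDbar_congr lam (Lp.coeFn_zero _ _ _).symm (Lp.coeFn_zero _ _ _).symm ?_
    intro j φ _
    simp
  add_mem' := by
    intro p q hp hq
    refine isWeakDbar_congr lam (Lp.coeFn_add p.1 q.1).symm (Lp.coeFn_add p.2 q.2).symm ?_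
    intro j φ hφ
    have a := hp j φ hφ
    have b := hq j φ hφ
    simp only [Pi.add_apply, PiLp.add_apply, add_mul]
    rw [integral_add (integrable_mul_test (memLp_coord (Lp.memLp p.2) j) hφ)
        (integrable_mul_test (memLp_coord (Lp.memLp q.2) j) hφ),
      integral_add (integrable_mul_test (Lp.memLp p.1) (hφ.zbar lam j))
        (integrable_mul_test (Lp.memLp q.1) (hφ.zbar lam j)), a, b]
    ring
  smul_mem' := by
    intro c p hp
    refine isWeakDbar_congr lam (Lp.coeFn_smul c p.1).symm (Lp.coeFn_smul c p.2).symm ?_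
    intro j φ hφ
    have a := hp j φ hφ
    simp only [Pi.smul_apply, PiLp.smul_apply, smul_eq_mul, mul_assoc, integral_const_mul, a,
      mul_neg]

theorem mem_dbarGraph {n : ℕ} {lam : Fin n → ℝ} {p : L2Fun n × L2Form n} :
    p ∈ dbarGraph lam ↔ IsWeakDbar lam p.1 p.2 := Iff.rfl

/-- `∂̄_b u` is determined by `u`. -/
theorem dbarGraph_functional {n : ℕ} (lam : Fin n → ℝ) (p : L2Fun n × L2Form n)
    (hp : p ∈ dbarGraph lam) (h0 : p.1 = 0) : p.2 = 0 := by
  obtain ⟨u, v⟩ := p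
  simp only at h0
  subst h0
  have hw : IsWeakDbar lam 0 v := isWeakDbar_congr lam (Lp.coeFn_zero _ _ _) (ae_eq_refl _) hp
  have hj : ∀ j, ∀ᵐ x ∂(heisVol n), v x j = 0 := by
    intro j
    refine ae_eq_zero_of_integral_contDiff_smul_eq_zero
      ((memLp_coord (Lp.memLp v) j).locallyIntegrable (by norm_num)) ?_
    intro g hg hg'
    have ht : IsTest (fun x => (g x : ℂ)) :=
      ⟨Complex.ofRealCLM.contDiff.comp hg, hg'.comp_left (g := fun r : ℝ => (r : ℂ)) (by simp)⟩
    have := hw j _ ht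
    simp only [Pi.zero_apply, zero_mul, integral_zero, neg_zero] at this
    rw [← this]
    refine integral_congr_ae (ae_of_all _ fun x => ?_)
    simp [Complex.real_smul, mul_comm]
  refine Lp.ext ?_
  filter_upwards [ae_all_iff.2 hj, Lp.coeFn_zero (EuclideanSpace ℂ (Fin n)) 2 (heisVol n)]
    with x hx h0
  rw [h0]
  ext j
  exact hx j

/-- `∂̄_b` on functions: the domain is the set of all `u ∈ L²` whose distributional `∂̄_b u` is in
`L²_{(0,1)}`. -/
def dbarB {n : ℕ} (lam : Fin n → ℝ) : L2Fun n →ₗ.[ℂ] L2Form n := (dbarGraph lam).toLinearPMap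

/-- The composition of unbounded operators, on its natural domain
`{s ∈ Dom f | f s ∈ Dom g}`. -/
def compPMap {E F G : Type*} [AddCommGroup E] [Module ℂ E] [AddCommGroup F] [Module ℂ F]
    [AddCommGroup G] [Module ℂ G] (g : F →ₗ.[ℂ] G) (f : E →ₗ.[ℂ] F) : E →ₗ.[ℂ] G where
  domain := (g.domain.comap f.toFun).map f.domain.subtype
  toFun := g.toFun ∘ₗ (f.toFun.restrict (p := g.domain.comap f.toFun) (q := g.domain)
      fun _ h => h) ∘ₗ
    (Submodule.equivMapOfInjective f.domain.subtype f.domain.injective_subtype _).symm.toLinearMap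

/-- The Kohn Laplacian `□_b^{(0)} = ∂̄_b^* ∂̄_b` (Gaffney extension) on functions. On functions
`∂̄_b^*` is the zero map on all of `L²(H_{n+1})`, so the conditions `s ∈ Dom ∂̄_b^*`,
`∂̄_b^* s ∈ Dom ∂̄_b` and the term `∂̄_b ∂̄_b^* s` are void. -/
def kohnLaplacian {n : ℕ} (lam : Fin n → ℝ) : L2Fun n →ₗ.[ℂ] L2Fun n :=
  compPMap (dbarB lam).adjoint (dbarB lam)

/-- `ℋ_b^0(H_{n+1}) = Ker □_b^{(0)}`. -/
def kerKohn {n : ℕ} (lam : Fin n → ℝ) : Submodule ℂ (L2Fun n) :=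
  (LinearMap.ker (kohnLaplacian lam).toFun).map (kohnLaplacian lam).domain.subtype

theorem mem_kerKohn {n : ℕ} {lam : Fin n → ℝ} {u : L2Fun n} :
    u ∈ kerKohn lam ↔ ∃ (hu : u ∈ (dbarB lam).domain)
      (hv : dbarB lam ⟨u, hu⟩ ∈ (dbarB lam).adjoint.domain),
        (dbarB lam).adjoint ⟨dbarB lam ⟨u, hu⟩, hv⟩ = 0 := by
  have key : ∀ (hu : u ∈ (dbarB lam).domain)
      (hv : dbarB lam ⟨u, hu⟩ ∈ (dbarB lam).adjoint.domain)
      (hw : u ∈ (kohnLaplacian lam).domain),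
      (kohnLaplacian lam).toFun ⟨u, hw⟩ =
        (dbarB lam).adjoint ⟨dbarB lam ⟨u, hu⟩, hv⟩ := by
    intro hu hv hw
    have e : (Submodule.equivMapOfInjective (dbarB lam).domain.subtype
        (dbarB lam).domain.injective_subtype
        ((dbarB lam).adjoint.domain.comap (dbarB lam).toFun)).symm ⟨u, hw⟩ = ⟨⟨u, hu⟩, hv⟩ := by
      rw [LinearEquiv.symm_apply_eq]
      rfl
    change (dbarB lam).adjoint.toFun (((dbarB lam).toFun.restrict fun _ h => h)
      ((Submodule.equivMapOfInjective (dbarB lam).domain.subtype _ _).symm ⟨u, hw⟩)) = _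
    rw [e]
    rfl
  constructor
  · rintro ⟨⟨_, hw⟩, h0, rfl⟩
    obtain ⟨⟨y, hy⟩, hy', rfl⟩ := id hw
    exact ⟨hy, hy', (key hy hy' hw).symm.trans h0⟩
  · rintro ⟨hu, hv, h0⟩
    have hw : u ∈ (kohnLaplacian lam).domain := ⟨⟨u, hu⟩, hv, rfl⟩
    exact ⟨⟨u, hw⟩, (key hu hv hw).trans h0, rfl⟩

theorem dense_dbarB_domain {n : ℕ} (lam : Fin n → ℝ) :
    Dense ((dbarB lam).domain : Set (L2Fun n)) := by
  refine (Lp.dense_hasCompactSupport_contDiff (F := ℂ) (μ := heisVol n) (p := 2)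
    (by norm_num)).mono ?_
  rintro f ⟨g, hfg, hg1, hg2⟩
  have hg : IsTest g := ⟨hg2, hg1⟩
  let w : Heis n → EuclideanSpace ℂ (Fin n) := fun x => WithLp.toLp 2 fun j => Zbar lam j g x
  have hw : MemLp w 2 (heisVol n) := by
    refine Continuous.memLp_of_hasCompactSupport
      ((PiLp.continuous_toLp 2 _).comp
        (continuous_pi fun j => (hg.zbar lam j).1.continuous)) ?_
    refine HasCompactSupport.intro' (K := tsupport g) hg.2 (isClosed_tsupport g) fun x hx => ?_
    have h0 : fderiv ℝ g x = 0 := by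
      have := (support_fderiv_subset ℝ (f := g)).trans (le_refl _)
      by_contra h
      exact hx (this h)
    ext j
    simp [w, Zbar, dzbar, dt, h0]
  refine ⟨(f, hw.toLp w), ?_, rfl⟩
  refine isWeakDbar_congr lam hfg.symm hw.coeFn_toLp.symm ?_
  intro j φ hφ
  exact integral_zbar_mul lam j hg hφ

/-- `Ker □_b^{(0)} = Ker ∂̄_b`. -/
theorem mem_kerKohn_iff {n : ℕ} {lam : Fin n → ℝ} {u : L2Fun n} :
    u ∈ kerKohn lam ↔ IsWeakDbar lam u (fun _ => 0) := by
  have hz : IsWeakDbar lam u (fun _ => 0) ↔ (u, (0 : L2Form n)) ∈ dbarGraph lam :=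
    ⟨isWeakDbar_congr lam (ae_eq_refl _) (Lp.coeFn_zero _ _ _).symm,
      isWeakDbar_congr lam (ae_eq_refl _) (Lp.coeFn_zero _ _ _)⟩
  rw [hz, mem_kerKohn]
  have hgr := Submodule.toLinearPMap_graph_eq (dbarGraph lam) (dbarGraph_functional lam)
  constructor
  · rintro ⟨hu, hv, h0⟩
    have h := LinearPMap.adjoint_isFormalAdjoint (dense_dbarB_domain lam)
      ⟨dbarB lam ⟨u, hu⟩, hv⟩ ⟨u, hu⟩
    rw [h0, inner_zero_left] at h
    have h1 : dbarB lam ⟨u, hu⟩ = 0 := inner_self_eq_zero.1 h.symm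
    have h2 := LinearPMap.mem_graph (dbarB lam) ⟨u, hu⟩
    rw [h1] at h2
    exact hgr ▸ h2
  · intro h
    have h' : (u, (0 : L2Form n)) ∈ (dbarB lam).graph := by
      rw [dbarB, hgr]
      exact h
    obtain ⟨⟨y, hy⟩, hy1, hy2⟩ := (LinearPMap.mem_graph_iff _).1 h'
    simp only at hy1 hy2
    subst hy1
    have hv : dbarB lam ⟨y, hy⟩ ∈ (dbarB lam).adjoint.domain := by
      rw [hy2]
      exact Submodule.zero_mem _
    refine ⟨hy, hv, ?_⟩
    have : (⟨dbarB lam ⟨y, hy⟩, hv⟩ : (dbarB lam).adjoint.domain) = 0 := Subtype.ext hy2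
    rw [this, LinearPMap.map_zero]

theorem isClosed_kerKohn {n : ℕ} (lam : Fin n → ℝ) : IsClosed (kerKohn lam : Set (L2Fun n)) := by
  have hconj : ∀ {φ : Heis n → ℂ}, IsTest φ → IsTest (fun x => conj (φ x)) := fun hφ =>
    ⟨Complex.conjCLE.contDiff.comp hφ.1, hφ.2.comp_left (g := fun c : ℂ => conj c) (by simp)⟩
  have hset : (kerKohn lam : Set (L2Fun n)) = ⋂ (j : Fin n) (φ : {φ : Heis n → ℂ // IsTest φ}),
      {u | ⟪(hconj (φ.2.zbar lam j)).memLp.toLp _, u⟫_ℂ = 0} := by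
    ext u
    simp only [SetLike.mem_coe, mem_kerKohn_iff, IsWeakDbar, Set.mem_iInter, Subtype.forall,
      Set.mem_ofPred_eq]
    refine forall_congr' fun j => forall_congr' fun φ => forall_congr' fun hφ => ?_
    have e : ⟪(hconj (hφ.zbar lam j)).memLp.toLp _, u⟫_ℂ =
        ∫ x, u x * Zbar lam j φ x ∂(heisVol n) := by
      rw [L2.inner_def]
      refine integral_congr_ae ?_
      filter_upwards [(hconj (hφ.zbar lam j)).memLp.coeFn_toLp] with x hx
      rw [hx]
      simp [RCLike.inner_apply]
    rw [e]
    simp [eq_comm]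
  rw [hset]
  exact isClosed_iInter fun j => isClosed_iInter fun φ =>
    isClosed_eq (continuous_const.inner continuous_id) continuous_const

instance instHasOrthogonalProjectionKerKohn {n : ℕ} (lam : Fin n → ℝ) : (kerKohn lam).HasOrthogonalProjection :=
  haveI : CompleteSpace (kerKohn lam) := (isClosed_kerKohn lam).completeSpace_coe
  inferInstance

/-- The Szegő projection `S^{(0)}`: the orthogonal projection of `L²(H_{n+1})` onto
`Ker □_b^{(0)}`. -/
def szegoProjection {n : ℕ} (lam : Fin n → ℝ) : L2Fun n →L[ℂ] L2Fun n :=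
  (kerKohn lam).starProjection

/-- The phase `φ_-(x, y)` for `x = (z, x_{2n+1})`, `y = (w, y_{2n+1})`. -/
def phaseMinus {n : ℕ} (lam : Fin n → ℝ) (x y : Heis n) : ℂ :=
  -(x.2 : ℂ) + y.2 + Complex.I * ∑ j, ((|lam j| * ‖x.1 j - y.1 j‖ ^ 2 : ℝ) : ℂ)
    + Complex.I * ∑ j, (lam j : ℂ) * (conj (x.1 j) * y.1 j - x.1 j * conj (y.1 j))

/-- `∫ (-i(φ(x,y) + iε))^{-(n+1)} u(y) dμ(y)`. -/
def regularizedIntegral {n : ℕ} (φ : Heis n → Heis n → ℂ) (ε : ℝ) (u : Heis n → ℂ)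
    (x : Heis n) : ℂ :=
  ∫ y, 1 / (-Complex.I * (φ x y + Complex.I * ε)) ^ (n + 1) * u y ∂(heisVol n)

/-- `I` is the bounded extension to `L²(H_{n+1})` of the operator `I_φ^{(0)}` on `C_c^∞(H_{n+1})`,
`(I_φ^{(0)} u)(x) = lim_{ε → 0+} ∫ (-i(φ(x,y) + iε))^{-(n+1)} u(y) dμ(y)`; the limit is required to
exist at every point `x`. -/
def IsL2Extension {n : ℕ} (φ : Heis n → Heis n → ℂ) (I : L2Fun n →L[ℂ] L2Fun n) : Prop :=
  ∀ (u : Heis n → ℂ) (hu : IsTest u), ∃ g : Heis n → ℂ,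
    (∀ x, Tendsto (fun ε : ℝ => regularizedIntegral φ ε u x) (𝓝[>] 0) (𝓝 (g x))) ∧
      I (hu.memLp.toLp u) =ᵐ[heisVol n] g

end Heisenberg

end

/-!
For the group law on `H_{n+1}` that makes the `Z̄_j` left-invariant, `-i φ_-(x, y)` is the conjugate
of the CR gauge `g = ∑ λ_j |z_j|² + i t` evaluated at `x⁻¹ y`. So the regularized integral of `u`
at `x` is the pairing of `u` with the left translate by `x` of the CR function
`k_ε = (g + ε)^{-(n+1)}`, and since `k_ε ∈ L²`, `u` may be replaced by `S⁽⁰⁾ u`.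

For CR functions `f ∈ L²`, integration by parts gives `∫ f k̄_ε = ∫ f P_ε`, where
`P_ε = 2ε (ḡ + ε)^{-(n+1)} (g + ε)^{-1}`: the difference `P_ε - k̄_ε` is a `Z̄`-divergence.
The kernel `P_ε` is integrable, its integral `2 π^{n+1} / (n! ∏ λ_j)` is independent of `ε`, and the
parabolic dilations map it to a multiple of `P_1`. It is therefore an approximate identity, and the
regularized integrals of `u` tend weakly to a multiple of `S⁽⁰⁾ u`. Their pointwise limit exists
because `n + 2` integrations by parts in `t` replace `k̄_ε` by the primitive `a log a - a`, which is
continuous up to `Re a = 0`; the two limits agree almost everywhere.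
-/

noncomputable section

namespace Heisenberg

variable {n : ℕ}

/-! ### The Heisenberg group -/

instance instIsAddHaarMeasureVolumeHeis : (volume : Measure (Heis n)).IsAddHaarMeasure :=
  haveI : (volume : Measure (Fin n → ℂ)).IsAddHaarMeasure := Measure.pi.isAddHaarMeasure _
  inferInstanceAs (((volume : Measure (Fin n → ℂ)).prod (volume : Measure ℝ)).IsAddHaarMeasure)

/-- The product of the Heisenberg group whose left-invariant vector fields include the `Z̄_j`.
The identity is `0` and the inverse of `y` is `-y`. -/
def mul (lam : Fin n → ℝ) (y v : Heis n) : Heis n :=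
  (y.1 + v.1, y.2 + v.2 + 2 * ∑ j, lam j * (v.1 j * conj (y.1 j)).im)

/-- The parabolic dilations, which are automorphisms of the Heisenberg group. -/
def dil (r : ℝ) (v : Heis n) : Heis n := (r • v.1, r ^ 2 * v.2)

/-- The complex gauge `∑ λ_j |v_j|² + i t`, a CR function; for positive `λ` the function
`-i φ_-(x, y)` is the conjugate of its value at `x⁻¹ y`. -/
def gauge (lam : Fin n → ℝ) (v : Heis n) : ℂ :=
  ((∑ j, lam j * ‖v.1 j‖ ^ 2 : ℝ) : ℂ) + Complex.I * v.2

theorem mul_neg_mul (lam : Fin n → ℝ) (y v : Heis n) : mul lam (-y) (mul lam y v) = v := by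
  have him (j : Fin n) : ((y.1 j + v.1 j) * conj (y.1 j)).im = (v.1 j * conj (y.1 j)).im := by
    simp only [Complex.mul_im, Complex.add_re, Complex.add_im, Complex.conj_re, Complex.conj_im]
    ring
  refine Prod.ext (by simp [mul]) ?_
  simp only [mul, Prod.fst_neg, Prod.snd_neg, Pi.add_apply, Pi.neg_apply, map_neg, mul_neg,
    Complex.neg_im, Finset.sum_neg_distrib, him]
  ring

theorem mul_mul_neg (lam : Fin n → ℝ) (y v : Heis n) : mul lam (mul lam y v) (-v) = y := by
  have him (j : Fin n) : (v.1 j * conj (y.1 j + v.1 j)).im = (v.1 j * conj (y.1 j)).im := by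
    simp only [map_add, Complex.mul_im, Complex.add_re, Complex.add_im, Complex.conj_re,
      Complex.conj_im]
    ring
  refine Prod.ext (by simp [mul]) ?_
  simp only [mul, Prod.fst_neg, Prod.snd_neg, Pi.add_apply, Pi.neg_apply, mul_neg,
    Complex.neg_im, Finset.sum_neg_distrib, neg_mul, him]
  ring

@[simp]
theorem mul_apply_zero (lam : Fin n → ℝ) (y : Heis n) : mul lam y 0 = y := by
  simp [mul]

@[simp]
theorem dil_zero (v : Heis n) : dil 0 v = 0 := by
  simp [dil]

theorem continuous_mul (lam : Fin n → ℝ) :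
    Continuous fun p : Heis n × Heis n => mul lam p.1 p.2 := by
  unfold mul
  fun_prop

theorem continuous_dil : Continuous fun p : ℝ × Heis n => dil p.1 p.2 := by
  unfold dil
  fun_prop

/-- Left translation as a homeomorphism. -/
def mulLeftHomeo (lam : Fin n → ℝ) (y : Heis n) : Heis n ≃ₜ Heis n where
  toFun := mul lam y
  invFun := mul lam (-y)
  left_inv v := mul_neg_mul lam y v
  right_inv v := by simpa using mul_neg_mul lam (-y) v
  continuous_toFun := (continuous_mul lam).comp (Continuous.prodMk_right y)
  continuous_invFun := (continuous_mul lam).comp (Continuous.prodMk_right (-y))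

/-- Right translation as a homeomorphism. -/
def mulRightHomeo (lam : Fin n → ℝ) (v : Heis n) : Heis n ≃ₜ Heis n where
  toFun y := mul lam y v
  invFun y := mul lam y (-v)
  left_inv y := mul_mul_neg lam y v
  right_inv y := by simpa using mul_mul_neg lam y (-v)
  continuous_toFun := (continuous_mul lam).comp (Continuous.prodMk_left v)
  continuous_invFun := (continuous_mul lam).comp (Continuous.prodMk_left (-v))

theorem measurePreserving_shear (w : Fin n → ℂ) (s : ℝ) {h : (Fin n → ℂ) → ℝ}
    (hh : Measurable h) :
    MeasurePreserving (fun v : Heis n => ((v.1 + w, v.2 + s + h v.1) : Heis n))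
      (heisVol n) (heisVol n) := by
  refine MeasurePreserving.smul_measure ?_ _
  refine MeasurePreserving.skew_product (g := fun a b => b + s + h a)
    (measurePreserving_add_right volume w) (by fun_prop) (ae_of_all _ fun a => ?_)
  simp only [add_assoc]
  exact (measurePreserving_add_right volume (s + h a)).map_eq

theorem measurePreserving_mul_left (lam : Fin n → ℝ) (y : Heis n) :
    MeasurePreserving (mul lam y) (heisVol n) (heisVol n) := by
  convert! measurePreserving_shear y.1 y.2
    (h := fun v => 2 * ∑ j, lam j * (v j * conj (y.1 j)).im) (by fun_prop) using 2 with v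
  simp [mul, add_comm]

theorem measurePreserving_mul_right (lam : Fin n → ℝ) (v : Heis n) :
    MeasurePreserving (fun y => mul lam y v) (heisVol n) (heisVol n) :=
  measurePreserving_shear v.1 v.2
    (h := fun y => 2 * ∑ j, lam j * (v.1 j * conj (y j)).im) (by fun_prop)

section Integral

variable {E : Type*} [NormedAddCommGroup E] [NormedSpace ℝ E]

theorem integral_mul_left (lam : Fin n → ℝ) (y : Heis n) (F : Heis n → E) :
    ∫ v, F (mul lam y v) ∂heisVol n = ∫ x, F x ∂heisVol n :=
  (measurePreserving_mul_left lam y).integral_comp (mulLeftHomeo lam y).measurableEmbedding F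

theorem integral_mul_right (lam : Fin n → ℝ) (v : Heis n) (F : Heis n → E) :
    ∫ y, F (mul lam y v) ∂heisVol n = ∫ x, F x ∂heisVol n :=
  (measurePreserving_mul_right lam v).integral_comp (mulRightHomeo lam v).measurableEmbedding F

theorem map_dil_volume {r : ℝ} (hr : 0 < r) :
    Measure.map (dil r) (volume : Measure (Heis n)) =
      ENNReal.ofReal ((r ^ (2 * n + 2))⁻¹) • volume := by
  have hprod := Measure.map_prod_map (volume : Measure (Fin n → ℂ)) (volume : Measure ℝ)
    (measurable_const_smul r) (measurable_const_smul (r ^ 2))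
  rw [Measure.map_addHaar_smul _ hr.ne', Measure.map_addHaar_smul _ (pow_pos hr 2).ne',
    Measure.prod_smul_left, Measure.prod_smul_right, smul_smul,
    ← ENNReal.ofReal_mul (abs_nonneg _)] at hprod
  refine hprod.symm.trans ?_
  change ENNReal.ofReal _ • (volume : Measure (Heis n)) = _
  rw [← abs_mul, abs_of_pos (by positivity)]
  simp only [Module.finrank_pi_fintype, Complex.finrank_real_complex, Finset.sum_const,
    Finset.card_univ, Fintype.card_fin, smul_eq_mul, Module.finrank_self, pow_one]
  rw [← mul_inv, ← pow_add, mul_comm n 2]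

theorem integral_dil {r : ℝ} (hr : 0 < r) (F : Heis n → E) :
    ∫ v, F (dil r v) ∂heisVol n = ((r ^ (2 * n + 2))⁻¹ : ℝ) • ∫ x, F x ∂heisVol n := by
  let e : Heis n ≃ₜ Heis n := (Homeomorph.smulOfNeZero r hr.ne').prodCongr
    (Homeomorph.smulOfNeZero (r ^ 2) (pow_pos hr 2).ne')
  have hemb : MeasurableEmbedding (dil r : Heis n → Heis n) := e.measurableEmbedding
  rw [integral_smul_nnreal_measure, integral_smul_nnreal_measure, ← hemb.integral_map,
    map_dil_volume hr, integral_smul_measure, ENNReal.toReal_ofReal (by positivity), smul_comm]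

end Integral

/-! ### The gauge and the phase -/

theorem gauge_re (lam : Fin n → ℝ) (v : Heis n) :
    (gauge lam v).re = ∑ j, lam j * ‖v.1 j‖ ^ 2 := by
  rw [gauge, Complex.add_re, Complex.ofReal_re]
  simp

theorem gauge_add_conj_gauge (lam : Fin n → ℝ) (v : Heis n) :
    gauge lam v + conj (gauge lam v) = 2 * ∑ j, (lam j : ℂ) * (conj (v.1 j) * v.1 j) := by
  rw [Complex.add_conj, gauge_re]
  push_cast
  simp only [Complex.conj_mul']

theorem gauge_dil (lam : Fin n → ℝ) (r : ℝ) (v : Heis n) :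
    gauge lam (dil r v) = r ^ 2 * gauge lam v := by
  simp only [gauge, dil, Pi.smul_apply, norm_smul, mul_pow, Real.norm_eq_abs, sq_abs]
  push_cast
  rw [mul_add, Finset.mul_sum]
  simp only [mul_left_comm]

theorem gauge_re_nonneg {lam : Fin n → ℝ} (hlam : ∀ j, 0 < lam j) (v : Heis n) :
    0 ≤ (gauge lam v).re := by
  rw [gauge_re]
  exact Finset.sum_nonneg fun j _ => mul_nonneg (hlam j).le (sq_nonneg _)

theorem add_ofReal_ne_zero {a : ℂ} (ha : 0 ≤ a.re) {ε : ℝ} (hε : 0 < ε) : a + ε ≠ 0 :=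
  ne_of_apply_ne Complex.re (by simpa using (add_pos_of_nonneg_of_pos ha hε).ne')

theorem gauge_add_ne_zero {lam : Fin n → ℝ} (hlam : ∀ j, 0 < lam j) {ε : ℝ} (hε : 0 < ε)
    (v : Heis n) : gauge lam v + ε ≠ 0 :=
  add_ofReal_ne_zero (gauge_re_nonneg hlam v) hε

theorem conj_gauge_add_ne_zero {lam : Fin n → ℝ} (hlam : ∀ j, 0 < lam j) {ε : ℝ} (hε : 0 < ε)
    (v : Heis n) : conj (gauge lam v) + ε ≠ 0 :=
  add_ofReal_ne_zero (a := conj (gauge lam v)) (gauge_re_nonneg hlam v) hε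

theorem phaseMinus_eq_gauge {lam : Fin n → ℝ} (hlam : ∀ j, 0 < lam j) (x y : Heis n) (ε : ℝ) :
    -Complex.I * (phaseMinus lam x y + Complex.I * ε) =
      conj (gauge lam (mul lam (-x) y)) + ε := by
  have hcross (a b : ℂ) : conj a * b - a * conj b = 2 * Complex.I * ((b * conj a).im : ℂ) := by
    have hconj : a * conj b = conj (b * conj a) := by simp [mul_comm]
    rw [mul_comm (conj a), hconj, Complex.sub_conj]
    push_cast
    ring
  have hnorm (j : Fin n) : ‖x.1 j - y.1 j‖ = ‖y.1 j - x.1 j‖ := norm_sub_rev _ _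
  simp only [phaseMinus, gauge, mul, hcross, abs_of_pos (hlam _), map_add, map_mul,
    Complex.conj_ofReal, Complex.conj_I, Prod.fst_neg, Prod.snd_neg, Pi.sub_apply, Pi.neg_apply,
    map_neg, mul_neg, Complex.neg_im, Finset.sum_neg_distrib, neg_add_eq_sub, hnorm]
  push_cast
  simp only [mul_left_comm _ (2 * Complex.I), ← Finset.mul_sum]
  linear_combination (-∑ j, (lam j : ℂ) * (‖y.1 j - x.1 j‖ : ℂ) ^ 2 - ε
    - 2 * Complex.I * ∑ j, (lam j : ℂ) * ((y.1 j * conj (x.1 j)).im : ℂ)) * Complex.I_sq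

/-! ### The vector fields `Z̄_j` -/

section Derivation

variable (lam : Fin n → ℝ) (j : Fin n) {f g : Heis n → ℂ} {x : Heis n}

theorem Zbar_eq_of_hasFDerivAt {f' : Heis n →L[ℝ] ℂ} (h : HasFDerivAt f f' x) :
    Zbar lam j f x = (1 / 2) * (f' (Pi.single j 1, 0) + Complex.I * f' (Pi.single j Complex.I, 0))
      + Complex.I * lam j * x.1 j * f' (0, 1) := by
  simp only [Zbar, dzbar, dt, h.fderiv]

theorem Zbar_const (c : ℂ) : Zbar lam j (fun _ => c) x = 0 := by
  rw [Zbar_eq_of_hasFDerivAt lam j (hasFDerivAt_const c x)]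
  simp

theorem Zbar_add (hf : DifferentiableAt ℝ f x) (hg : DifferentiableAt ℝ g x) :
    Zbar lam j (fun y => f y + g y) x = Zbar lam j f x + Zbar lam j g x := by
  rw [Zbar_eq_of_hasFDerivAt lam j (hf.hasFDerivAt.fun_add hg.hasFDerivAt),
    Zbar_eq_of_hasFDerivAt lam j hf.hasFDerivAt, Zbar_eq_of_hasFDerivAt lam j hg.hasFDerivAt]
  simp only [add_apply]
  ring

theorem Zbar_sum {f : Fin n → Heis n → ℂ} (hf : ∀ k, DifferentiableAt ℝ (f k) x) :
    Zbar lam j (fun y => ∑ k, f k y) x = ∑ k, Zbar lam j (f k) x := by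
  rw [Zbar_eq_of_hasFDerivAt lam j (HasFDerivAt.fun_sum fun k _ => (hf k).hasFDerivAt)]
  simp only [Zbar, dzbar, dt, FunLike.coe_sum, Finset.sum_apply, Finset.sum_add_distrib,
    Finset.mul_sum, mul_add]

theorem Zbar_mul (hf : DifferentiableAt ℝ f x) (hg : DifferentiableAt ℝ g x) :
    Zbar lam j (fun y => f y * g y) x = f x * Zbar lam j g x + Zbar lam j f x * g x := by
  rw [Zbar_eq_of_hasFDerivAt lam j (hf.hasFDerivAt.fun_mul hg.hasFDerivAt),
    Zbar_eq_of_hasFDerivAt lam j hf.hasFDerivAt, Zbar_eq_of_hasFDerivAt lam j hg.hasFDerivAt]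
  simp only [add_apply, smul_apply, smul_eq_mul]
  ring

theorem Zbar_const_mul (c : ℂ) (hf : DifferentiableAt ℝ f x) :
    Zbar lam j (fun y => c * f y) x = c * Zbar lam j f x := by
  rw [Zbar_mul lam j (differentiableAt_const c) hf, Zbar_const, zero_mul, add_zero]

theorem Zbar_comp {F : ℂ → ℂ} {F' : ℂ} (hF : HasDerivAt F F' (f x))
    (hf : DifferentiableAt ℝ f x) : Zbar lam j (fun y => F (f y)) x = F' * Zbar lam j f x := by
  have hcomp : HasFDerivAt (fun y => F (f y)) _ x :=
    (hF.hasFDerivAt.restrictScalars ℝ).comp x hf.hasFDerivAt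
  rw [Zbar_eq_of_hasFDerivAt lam j hcomp, Zbar_eq_of_hasFDerivAt lam j hf.hasFDerivAt]
  simp only [ContinuousLinearMap.comp_apply, ContinuousLinearMap.coe_restrictScalars',
    ContinuousLinearMap.toSpanSingleton_apply, smul_eq_mul]
  ring

theorem Zbar_inv_pow (m : ℕ) (hx : f x ≠ 0) (hf : DifferentiableAt ℝ f x) :
    Zbar lam j (fun y => (f y ^ m)⁻¹) x = -m * (f x ^ (m + 1))⁻¹ * Zbar lam j f x := by
  refine Zbar_comp lam j (F := fun a => (a ^ m)⁻¹) ?_ hf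
  convert! (hasDerivAt_pow m (f x)).fun_inv (pow_ne_zero m hx) using 1
  rcases m with _ | m
  · simp
  · simp only [Nat.add_sub_cancel]
    field_simp
    ring

theorem Zbar_inv (hx : f x ≠ 0) (hf : DifferentiableAt ℝ f x) :
    Zbar lam j (fun y => (f y)⁻¹) x = -(f x ^ 2)⁻¹ * Zbar lam j f x := by
  simpa using Zbar_inv_pow lam j 1 hx hf

/-- The coordinate `z_k` as a real-linear functional. -/
def coordCLM (k : Fin n) : Heis n →L[ℝ] ℂ :=
  (ContinuousLinearMap.proj (R := ℝ) (φ := fun _ : Fin n => ℂ) k).comp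
    (ContinuousLinearMap.fst ℝ (Fin n → ℂ) ℝ)

theorem Zbar_coord (k : Fin n) : Zbar lam j (fun y => y.1 k) x = 0 := by
  refine (Zbar_eq_of_hasFDerivAt lam j (coordCLM k).hasFDerivAt).trans ?_
  rcases eq_or_ne k j with rfl | h
  · simp [coordCLM]
  · simp [coordCLM, h]

theorem Zbar_conj_coord (k : Fin n) :
    Zbar lam j (fun y => conj (y.1 k)) x = if k = j then 1 else 0 := by
  refine (Zbar_eq_of_hasFDerivAt lam j
    ((Complex.conjCLE : ℂ →L[ℝ] ℂ).comp (coordCLM k)).hasFDerivAt).trans ?_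
  rcases eq_or_ne k j with rfl | h
  · norm_num [coordCLM]
  · simp [coordCLM, h]

theorem Zbar_time : Zbar lam j (fun y => (y.2 : ℂ)) x = Complex.I * lam j * x.1 j := by
  refine (Zbar_eq_of_hasFDerivAt lam j
    (Complex.ofRealCLM.comp (ContinuousLinearMap.snd ℝ (Fin n → ℂ) ℝ)).hasFDerivAt).trans ?_
  simp

theorem contDiff_Zbar (hf : ContDiff ℝ ∞ f) : ContDiff ℝ ∞ (Zbar lam j f) := by
  have hfderiv (e : Heis n) : ContDiff ℝ ∞ (fun y => fderiv ℝ f y e) :=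
    (hf.fderiv_right (by simp)).clm_apply contDiff_const
  exact (contDiff_const.mul ((hfderiv _).add (contDiff_const.mul (hfderiv _)))).add
    ((contDiff_const.mul (contDiff_coord j)).mul (hfderiv _))

end Derivation

section LeftInvariance

/-- The derivative of the left translation by `(w, s)`, at any point. -/
def mulLeftCLM (lam : Fin n → ℝ) (w : Fin n → ℂ) : Heis n →L[ℝ] Heis n :=
  (ContinuousLinearMap.fst ℝ (Fin n → ℂ) ℝ).prod (ContinuousLinearMap.snd ℝ (Fin n → ℂ) ℝ +
    (2 : ℝ) • ∑ j, lam j • Complex.imCLM.comp ((ContinuousLinearMap.mul ℝ ℂ (conj (w j))).comp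
      (coordCLM j)))

theorem mulLeftCLM_apply (lam : Fin n → ℝ) (w : Fin n → ℂ) (v : Heis n) :
    mulLeftCLM lam w v = (v.1, v.2 + 2 * ∑ j, lam j * (v.1 j * conj (w j)).im) := by
  simp [mulLeftCLM, coordCLM, mul_comm]

theorem mul_eq_add_mulLeftCLM (lam : Fin n → ℝ) (y v : Heis n) :
    mul lam y v = y + mulLeftCLM lam y.1 v := by
  rw [mulLeftCLM_apply]
  exact Prod.ext rfl (add_assoc _ _ _)

theorem hasFDerivAt_mul_left (lam : Fin n → ℝ) (y v : Heis n) :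
    HasFDerivAt (mul lam y) (mulLeftCLM lam y.1) v := by
  simpa only [← mul_eq_add_mulLeftCLM] using (mulLeftCLM lam y.1).hasFDerivAt.const_add y

theorem contDiff_mul_left (lam : Fin n → ℝ) (y : Heis n) : ContDiff ℝ ∞ (mul lam y) := by
  rw [funext (mul_eq_add_mulLeftCLM lam y)]
  exact contDiff_const.add (mulLeftCLM lam y.1).contDiff

theorem Zbar_comp_mul_left (lam : Fin n → ℝ) (j : Fin n) (y : Heis n) {f : Heis n → ℂ}
    (hf : Differentiable ℝ f) (v : Heis n) :
    Zbar lam j (fun v => f (mul lam y v)) v = Zbar lam j f (mul lam y v) := by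
  have hsplit (c : ℂ) : mulLeftCLM lam y.1 (Pi.single j c, 0) =
      (Pi.single j c, 0) + (2 * (lam j * (c * conj (y.1 j)).im)) • ((0, 1) : Heis n) := by
    rw [mulLeftCLM_apply]
    refine Prod.ext (by simp) ?_
    simp [Pi.single_apply, ite_mul, apply_ite Complex.im]
  have htime : mulLeftCLM lam y.1 (0, 1) = (0, 1) := by
    simp [mulLeftCLM_apply]
  have hcomp : HasFDerivAt (fun v => f (mul lam y v)) _ v :=
    (hf _).hasFDerivAt.comp v (hasFDerivAt_mul_left lam y v)
  rw [Zbar_eq_of_hasFDerivAt lam j hcomp, Zbar_eq_of_hasFDerivAt lam j (hf _).hasFDerivAt]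
  simp only [ContinuousLinearMap.comp_apply, hsplit, htime, map_add, map_smul]
  have hcoeff : (1 / 2 : ℂ) * ((2 * (lam j * (1 * conj (y.1 j)).im) : ℝ) +
      Complex.I * (2 * (lam j * (Complex.I * conj (y.1 j)).im) : ℝ)) =
      Complex.I * lam j * y.1 j := by
    apply Complex.ext <;> simp
  have hfst : (mul lam y v).1 j = y.1 j + v.1 j := rfl
  simp only [Complex.real_smul, hfst]
  linear_combination fderiv ℝ f (mul lam y v) (0, 1) * hcoeff

end LeftInvariance

section Gauge

variable (lam : Fin n → ℝ)

theorem gauge_eq_sum (v : Heis n) :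
    gauge lam v = ∑ k, (lam k : ℂ) * (conj (v.1 k) * v.1 k) + Complex.I * v.2 := by
  simp [gauge, Complex.conj_mul']

theorem conj_gauge_eq_sum (v : Heis n) :
    conj (gauge lam v) = ∑ k, (lam k : ℂ) * (conj (v.1 k) * v.1 k) + -Complex.I * v.2 := by
  simp [gauge, Complex.conj_mul']

theorem contDiff_conj_coord (j : Fin n) : ContDiff ℝ ∞ (fun v : Heis n => conj (v.1 j)) :=
  Complex.conjCLE.contDiff.comp (contDiff_coord j)

theorem contDiff_time : ContDiff ℝ ∞ (fun v : Heis n => (v.2 : ℂ)) :=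
  Complex.ofRealCLM.contDiff.comp contDiff_snd

theorem contDiff_weighted_norm_sq :
    ContDiff ℝ ∞ (fun v : Heis n => ∑ k, (lam k : ℂ) * (conj (v.1 k) * v.1 k)) :=
  ContDiff.sum fun k _ => contDiff_const.mul ((contDiff_conj_coord k).mul (contDiff_coord k))

theorem contDiff_gauge : ContDiff ℝ ∞ (gauge lam) := by
  rw [funext (gauge_eq_sum lam)]
  exact (contDiff_weighted_norm_sq lam).add (contDiff_const.mul contDiff_time)

theorem contDiff_conj_gauge : ContDiff ℝ ∞ (fun v : Heis n => conj (gauge lam v)) :=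
  Complex.conjCLE.contDiff.comp (contDiff_gauge lam)

variable (j : Fin n) (v : Heis n)

theorem Zbar_weighted_norm_sq :
    Zbar lam j (fun v => ∑ k, (lam k : ℂ) * (conj (v.1 k) * v.1 k)) v = lam j * v.1 j := by
  have hcoord (k : Fin n) : DifferentiableAt ℝ (fun v : Heis n => v.1 k) v :=
    (contDiff_coord k).contDiffAt.differentiableAt (by simp)
  have hconj (k : Fin n) : DifferentiableAt ℝ (fun v : Heis n => conj (v.1 k)) v :=
    (contDiff_conj_coord k).contDiffAt.differentiableAt (by simp)
  have hmul (k : Fin n) := (hconj k).fun_mul (hcoord k)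
  rw [Zbar_sum lam j fun k => (hmul k).const_mul _]
  simp only [Zbar_const_mul lam j _ (hmul _), Zbar_mul lam j (hconj _) (hcoord _), Zbar_coord,
    Zbar_conj_coord, mul_ite, ite_mul, one_mul, zero_mul, mul_zero, zero_add,
    Finset.sum_ite_eq', Finset.mem_univ, if_true]

theorem Zbar_weighted_norm_sq_add (c : ℂ) :
    Zbar lam j (fun v => ∑ k, (lam k : ℂ) * (conj (v.1 k) * v.1 k) + c * v.2) v =
      lam j * v.1 j + c * (Complex.I * lam j * v.1 j) := by
  have htime := contDiff_time.contDiffAt.differentiableAt (x := v) (by simp)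
  rw [Zbar_add lam j
      ((contDiff_weighted_norm_sq lam).contDiffAt.differentiableAt (by simp)) (htime.const_mul c),
    Zbar_const_mul lam j c htime, Zbar_weighted_norm_sq, Zbar_time]

theorem Zbar_gauge : Zbar lam j (gauge lam) v = 0 := by
  rw [funext (gauge_eq_sum lam), Zbar_weighted_norm_sq_add]
  linear_combination lam j * v.1 j * Complex.I_sq

theorem Zbar_conj_gauge : Zbar lam j (fun v => conj (gauge lam v)) v = 2 * lam j * v.1 j := by
  rw [funext (conj_gauge_eq_sum lam), Zbar_weighted_norm_sq_add]
  linear_combination -lam j * v.1 j * Complex.I_sq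

end Gauge

/-! ### Weak CR functions -/

section Cutoff

theorem Zbar_congr (lam : Fin n → ℝ) (j : Fin n) {f g : Heis n → ℂ} {x : Heis n}
    (h : f =ᶠ[𝓝 x] g) : Zbar lam j f x = Zbar lam j g x := by
  simp only [Zbar, dzbar, dt, h.fderiv_eq]

theorem Zbar_eq_zero_of_notMem_tsupport (lam : Fin n → ℝ) (j : Fin n) {f : Heis n → ℂ}
    {x : Heis n} (hx : x ∉ tsupport f) : Zbar lam j f x = 0 :=
  (Zbar_congr lam j (notMem_tsupport_iff_eventuallyEq.1 hx)).trans (Zbar_const lam j 0)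

theorem Zbar_comp_smul (lam : Fin n → ℝ) (j : Fin n) {η : Heis n → ℂ} (hη : Differentiable ℝ η)
    (r : ℝ) (x : Heis n) :
    Zbar lam j (fun x => η (r • x)) x =
      r * dzbar j η (r • x) + Complex.I * lam j * ((r • x).1 j * dt η (r • x)) := by
  have hcomp : HasFDerivAt (fun x => η (r • x)) _ x :=
    (hη (r • x)).hasFDerivAt.comp x ((hasFDerivAt_id x).const_smul r)
  rw [Zbar_eq_of_hasFDerivAt lam j hcomp]
  simp only [ContinuousLinearMap.comp_smulₛₗ, Real.ringHom_apply, ContinuousLinearMap.comp_id,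
    smul_apply, Complex.real_smul, dzbar, Prod.smul_fst, Pi.smul_apply, dt]
  ring

theorem IsTest.dzbar {η : Heis n → ℂ} (hη : IsTest η) (j : Fin n) : IsTest (dzbar j η) :=
  ((hη.fderiv_apply _).add ((hη.fderiv_apply _).mul_left contDiff_const)).mul_left contDiff_const

theorem IsTest.exists_bound {η : Heis n → ℂ} (hη : IsTest η) : ∃ C : ℝ, ∀ x, ‖η x‖ ≤ C :=
  hη.2.exists_bound_of_continuous hη.1.continuous

theorem exists_isTest_eventuallyEq_one (n : ℕ) :
    ∃ η : Heis n → ℂ, IsTest η ∧ ∀ x ∈ Metric.ball 0 1, η x = 1 := by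
  let χ : ContDiffBump (0 : Heis n) := ⟨1, 2, one_pos, one_lt_two⟩
  refine ⟨fun x => (χ x : ℂ), ⟨Complex.ofRealCLM.contDiff.comp χ.contDiff,
    χ.hasCompactSupport.comp_left (g := fun r : ℝ => (r : ℂ)) (by simp)⟩, fun x hx => ?_⟩
  simp [χ.one_of_mem_closedBall (Metric.ball_subset_closedBall hx)]

theorem exists_isTest_exhaustion (lam : Fin n → ℝ) (j : Fin n) :
    ∃ (χ : ℕ → Heis n → ℂ) (C : ℝ), (∀ m, IsTest (χ m)) ∧ (∀ m x, ‖χ m x‖ ≤ C) ∧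
      (∀ m x, ‖Zbar lam j (χ m) x‖ ≤ C) ∧
      ∀ K : Set (Heis n), IsCompact K → ∀ᶠ m in atTop, ∀ x ∈ K, χ m =ᶠ[𝓝 x] fun _ => 1 := by
  obtain ⟨η, hη, hη1⟩ := exists_isTest_eventuallyEq_one n
  obtain ⟨A, hA⟩ := hη.exists_bound
  obtain ⟨B, hB⟩ := (hη.dzbar j).exists_bound
  obtain ⟨D, hD⟩ := ((hη.fderiv_apply (0, 1)).mul_left (contDiff_coord j)).exists_bound
  let r (m : ℕ) : ℝ := (m + 1 : ℝ)⁻¹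
  have hr (m : ℕ) : 0 < r m := by positivity
  have hr1 (m : ℕ) : r m ≤ 1 := inv_le_one_of_one_le₀ (by simp)
  refine ⟨fun m x => η (r m • x), max A (B + ‖Complex.I * lam j‖ * D), fun m => ?_,
    fun m x => (hA _).trans (le_max_left _ _), fun m x => ?_, fun K hK => ?_⟩
  · exact ⟨hη.1.comp (contDiff_const_smul (r m)), hη.2.comp_smul (hr m).ne'⟩
  · refine le_trans ?_ (le_max_right _ _)
    rw [Zbar_comp_smul lam j (hη.1.differentiable (by simp))]
    refine norm_add_le_of_le ?_ ?_
    · rw [norm_mul, Complex.norm_real, Real.norm_of_nonneg (hr m).le]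
      exact (mul_le_of_le_one_left (norm_nonneg _) (hr1 m)).trans (hB _)
    · rw [norm_mul]
      exact mul_le_mul_of_nonneg_left (hD _) (norm_nonneg _)
  · obtain ⟨R, hR⟩ := hK.isBounded.exists_norm_le
    filter_upwards [eventually_ge_atTop ⌈R⌉₊] with m hm x hx
    have hxm : ‖x‖ < m + 1 := (hR x hx).trans_lt (by linarith [Nat.ceil_le.1 hm])
    filter_upwards [isOpen_lt continuous_norm continuous_const |>.mem_nhds hxm] with y hy
    refine hη1 _ ?_
    rw [mem_ball_zero_iff, norm_smul, Real.norm_of_nonneg (hr m).le]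
    exact (inv_mul_lt_one₀ (by positivity)).2 hy

end Cutoff

section IntegrationByParts

theorem integral_Zbar_mul_of_contDiff (lam : Fin n → ℝ) (j : Fin n) {k φ : Heis n → ℂ}
    (hk : ContDiff ℝ ∞ k) (hφ : IsTest φ) :
    ∫ x, Zbar lam j k x * φ x ∂(heisVol n) = -∫ x, k x * Zbar lam j φ x ∂(heisVol n) := by
  obtain ⟨χ, -, hχ, -, -, hχ1⟩ := exists_isTest_exhaustion lam j
  obtain ⟨m, hm⟩ := (hχ1 _ hφ.2).exists
  have heq {x : Heis n} (hx : x ∈ tsupport φ) : (fun y => k y * χ m y) =ᶠ[𝓝 x] k := by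
    filter_upwards [hm x hx] with y hy using by rw [hy, mul_one]
  convert! integral_zbar_mul lam j ((hχ m).mul_left hk) hφ using 3 with x x
  · by_cases hx : x ∈ tsupport φ
    · rw [Zbar_congr lam j (heq hx)]
    · simp only [image_eq_zero_of_notMem_tsupport hx, mul_zero]
  · funext x
    by_cases hx : x ∈ tsupport φ
    · exact congrArg (· * _) (heq hx).eq_of_nhds.symm
    · simp only [Zbar_eq_zero_of_notMem_tsupport lam j hx, mul_zero]

theorem IsTest.comp_mul_left {φ : Heis n → ℂ} (hφ : IsTest φ) (lam : Fin n → ℝ) (y : Heis n) :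
    IsTest (fun v => φ (mul lam y v)) :=
  ⟨hφ.1.comp (contDiff_mul_left lam y), hφ.2.comp_homeomorph (mulLeftHomeo lam y)⟩

variable {lam : Fin n → ℝ}

theorem isWeakDbar_zero_of_Zbar_eq_zero {k : Heis n → ℂ} (hk : ContDiff ℝ ∞ k)
    (h : ∀ j x, Zbar lam j k x = 0) : IsWeakDbar lam k (fun _ => 0) := by
  intro j φ hφ
  simpa only [h, PiLp.zero_apply] using integral_Zbar_mul_of_contDiff lam j hk hφ

theorem IsWeakDbar.comp_mul_left {f : Heis n → ℂ} (h : IsWeakDbar lam f (fun _ => 0))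
    (y : Heis n) : IsWeakDbar lam (fun v => f (mul lam y v)) (fun _ => 0) := by
  intro j φ hφ
  have hψ := hφ.comp_mul_left lam (-y)
  have hinv := integral_mul_left lam y fun x =>
    f x * Zbar lam j (fun v => φ (mul lam (-y) v)) x
  simp only [← Zbar_comp_mul_left lam j y (hψ.1.differentiable (by simp)), mul_neg_mul] at hinv
  rw [hinv]
  simpa only [PiLp.zero_apply, zero_mul, integral_zero] using h j _ hψ

/-- Truncation by cutoffs allows test functions that are merely in the graph of `Z̄_j`. -/
theorem IsWeakDbar.integral_mul_Zbar {f : Heis n → ℂ} (h : IsWeakDbar lam f (fun _ => 0))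
    (hf : MemLp f 2 (heisVol n)) (j : Fin n) {φ : Heis n → ℂ} (hφ : ContDiff ℝ ∞ φ)
    (hφ2 : MemLp φ 2 (heisVol n)) (hZφ : MemLp (Zbar lam j φ) 2 (heisVol n)) :
    ∫ x, f x * Zbar lam j φ x ∂(heisVol n) = 0 := by
  obtain ⟨χ, C, hχ, hC, hZC, hχ1⟩ := exists_isTest_exhaustion lam j
  have hzero (m : ℕ) : ∫ x, f x * Zbar lam j (fun y => φ y * χ m y) x ∂heisVol n = 0 := by
    simpa [eq_comm] using h j _ ((hχ m).mul_left hφ)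
  have hZ (m : ℕ) (x : Heis n) : Zbar lam j (fun y => φ y * χ m y) x =
      φ x * Zbar lam j (χ m) x + Zbar lam j φ x * χ m x :=
    Zbar_mul lam j (hφ.differentiable (by simp) x) ((hχ m).1.differentiable (by simp) x)
  refine tendsto_nhds_unique (f := fun m => ∫ x, f x * Zbar lam j (fun y => φ y * χ m y) x
    ∂heisVol n) (l := atTop) ?_ (by simpa only [hzero] using tendsto_const_nhds)
  refine tendsto_integral_of_dominated_convergence
    (fun x => (‖f x * φ x‖ + ‖f x * Zbar lam j φ x‖) * C) (fun m => ?_)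
    (((hf.integrable_mul hφ2).norm.add (hf.integrable_mul hZφ).norm).mul_const C)
    (fun m => ae_of_all _ fun x => ?_) (ae_of_all _ fun x => ?_)
  · exact hf.aestronglyMeasurable.mul
      (((hχ m).mul_left hφ).zbar lam j).1.continuous.aestronglyMeasurable
  · rw [hZ, mul_add, ← mul_assoc, ← mul_assoc, add_mul]
    refine norm_add_le_of_le ?_ ?_
    · exact (norm_mul_le _ _).trans (mul_le_mul_of_nonneg_left (hZC m x) (norm_nonneg _))
    · exact (norm_mul_le _ _).trans (mul_le_mul_of_nonneg_left (hC m x) (norm_nonneg _))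
  · refine tendsto_const_nhds.congr' ?_
    filter_upwards [hχ1 {x} isCompact_singleton] with m hm
    have hx := hm x rfl
    rw [hZ, Zbar_congr lam j hx, Zbar_const, hx.eq_of_nhds, mul_zero, zero_add, mul_one]

end IntegrationByParts

/-! ### Rational and Gaussian integrals -/

section RationalIntegrals

variable {a : ℝ}

theorem sub_I_mul_ne_zero (ha : 0 < a) (t : ℝ) : (a : ℂ) - Complex.I * t ≠ 0 :=
  ne_of_apply_ne Complex.re (by simpa using ha.ne')

theorem add_I_mul_ne_zero (ha : 0 < a) (t : ℝ) : (a : ℂ) + Complex.I * t ≠ 0 := by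
  simpa using sub_I_mul_ne_zero ha (-t)

theorem sub_I_mul_mul_add (a t : ℝ) :
    ((a : ℂ) - Complex.I * t) * (a + Complex.I * t) = ((a ^ 2 + t ^ 2 : ℝ) : ℂ) := by
  push_cast
  linear_combination (-(t : ℂ) ^ 2) * Complex.I_sq

theorem norm_add_I_mul (a t : ℝ) : ‖(a : ℂ) + Complex.I * t‖ = ‖(a : ℂ) - Complex.I * t‖ := by
  rw [← RCLike.norm_conj]
  simp [sub_eq_add_neg]

theorem norm_sub_I_mul_sq (a t : ℝ) : ‖(a : ℂ) - Complex.I * t‖ ^ 2 = a ^ 2 + t ^ 2 := by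
  have h := congrArg norm (sub_I_mul_mul_add a t)
  rwa [norm_mul, norm_add_I_mul, ← sq, Complex.norm_of_nonneg (by positivity)] at h

theorem inv_sq_add_sq_eq (ha : 0 < a) (t : ℝ) :
    (a ^ 2 + t ^ 2)⁻¹ = (a ^ 2)⁻¹ * (1 + (a⁻¹ * t) ^ 2)⁻¹ := by
  rw [← mul_inv]
  congr 1
  field_simp

theorem integrable_inv_sq_add_sq (ha : 0 < a) : Integrable fun t : ℝ => (a ^ 2 + t ^ 2)⁻¹ := by
  simp only [inv_sq_add_sq_eq ha]
  exact (integrable_inv_one_add_sq.comp_mul_left' (inv_ne_zero ha.ne')).const_mul _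

theorem integral_inv_sq_add_sq (ha : 0 < a) : ∫ t : ℝ, (a ^ 2 + t ^ 2)⁻¹ = Real.pi / a := by
  have h := Measure.integral_comp_mul_left (fun t : ℝ => (1 + t ^ 2)⁻¹) a⁻¹
  rw [integral_univ_inv_one_add_sq, inv_inv, abs_of_pos ha, smul_eq_mul] at h
  simp only [inv_sq_add_sq_eq ha]
  rw [integral_const_mul, h]
  field_simp

theorem integrable_prod_inv_pow_mul_inv_sq_add_sq {X : Type*} [MeasurableSpace X] {μ : Measure X}
    [SFinite μ] {A : X → ℝ} (hA : Measurable A) (hpos : ∀ x, 0 < A x) {m : ℕ}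
    (hint : Integrable (fun x => (A x ^ (m + 1))⁻¹) μ) :
    Integrable (fun p : X × ℝ => (A p.1 ^ m)⁻¹ * (A p.1 ^ 2 + p.2 ^ 2)⁻¹) (μ.prod volume) := by
  have hmeas : Measurable fun p : X × ℝ => (A p.1 ^ m)⁻¹ * (A p.1 ^ 2 + p.2 ^ 2)⁻¹ := by fun_prop
  have hinner (x : X) : ∫ t : ℝ, ‖(A x ^ m)⁻¹ * (A x ^ 2 + t ^ 2)⁻¹‖ =
      Real.pi * (A x ^ (m + 1))⁻¹ := by
    have hx := hpos x
    have hnonneg (t : ℝ) : 0 ≤ (A x ^ m)⁻¹ * (A x ^ 2 + t ^ 2)⁻¹ := by positivity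
    simp only [Real.norm_of_nonneg (hnonneg _)]
    rw [integral_const_mul, integral_inv_sq_add_sq hx, pow_succ]
    field_simp
  refine (integrable_prod_iff hmeas.aestronglyMeasurable).2
    ⟨ae_of_all _ fun x => (integrable_inv_sq_add_sq (hpos x)).const_mul (A x ^ m)⁻¹, ?_⟩
  simp only [hinner]
  exact hint.const_mul _

theorem continuous_inv_pow_sub_I_mul (ha : 0 < a) (m : ℕ) :
    Continuous fun t : ℝ => (((a : ℂ) - Complex.I * t) ^ m)⁻¹ :=
  Continuous.inv₀ (by fun_prop) fun t => pow_ne_zero _ (sub_I_mul_ne_zero ha t)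

theorem norm_inv_pow_sub_I_mul_le (ha : 0 < a) (m : ℕ) (t : ℝ) :
    ‖(((a : ℂ) - Complex.I * t) ^ (m + 2))⁻¹‖ ≤ (a ^ m)⁻¹ * (a ^ 2 + t ^ 2)⁻¹ := by
  have h : a ≤ ‖(a : ℂ) - Complex.I * t‖ := by
    simpa using Complex.re_le_norm ((a : ℂ) - Complex.I * t)
  rw [norm_inv, norm_pow, pow_add, norm_sub_I_mul_sq, mul_inv]
  gcongr

theorem integrable_inv_pow_sub_I_mul (ha : 0 < a) (m : ℕ) :
    Integrable fun t : ℝ => (((a : ℂ) - Complex.I * t) ^ (m + 2))⁻¹ :=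
  ((integrable_inv_sq_add_sq ha).const_mul (a ^ m)⁻¹).mono'
    (continuous_inv_pow_sub_I_mul ha _).aestronglyMeasurable
    (ae_of_all _ (norm_inv_pow_sub_I_mul_le ha m))

theorem hasDerivAt_inv_pow_sub_I_mul (ha : 0 < a) (m : ℕ) (t : ℝ) :
    HasDerivAt (fun t : ℝ => (((a : ℂ) - Complex.I * t) ^ (m + 1))⁻¹)
      ((m + 1) * Complex.I * (((a : ℂ) - Complex.I * t) ^ (m + 2))⁻¹) t := by
  have h0 := sub_I_mul_ne_zero ha t
  have h1 : HasDerivAt (fun t : ℝ => (a : ℂ) - Complex.I * t) (-Complex.I) t := by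
    simpa using ((Complex.ofRealCLM.hasDerivAt (x := t)).const_mul Complex.I).const_sub (a : ℂ)
  convert! (h1.fun_pow (m + 1)).inv (pow_ne_zero _ h0) using 1
  simp only [Nat.add_sub_cancel]
  push_cast
  field_simp
  ring

theorem tendsto_inv_pow_sub_I_mul (a : ℝ) (m : ℕ) {l : Filter ℝ}
    (hl : Tendsto (fun t : ℝ => |t|) l atTop) :
    Tendsto (fun t : ℝ => (((a : ℂ) - Complex.I * t) ^ (m + 1))⁻¹) l (𝓝 0) := by
  have hnorm (t : ℝ) : |t| ≤ ‖(a : ℂ) - Complex.I * t‖ := by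
    simpa using Complex.abs_im_le_norm ((a : ℂ) - Complex.I * t)
  rw [tendsto_zero_iff_norm_tendsto_zero]
  simp only [norm_inv, norm_pow]
  exact ((tendsto_pow_atTop (Nat.succ_ne_zero m)).comp
    (tendsto_atTop_mono hnorm hl)).inv_tendsto_atTop

theorem integral_inv_pow_sub_I_mul (ha : 0 < a) (m : ℕ) :
    ∫ t : ℝ, (((a : ℂ) - Complex.I * t) ^ (m + 2))⁻¹ = 0 := by
  have hm : (m + 1 : ℂ) * Complex.I ≠ 0 :=
    mul_ne_zero (Nat.cast_add_one_ne_zero m) Complex.I_ne_zero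
  have h := integral_of_hasDerivAt_of_tendsto (hasDerivAt_inv_pow_sub_I_mul ha m)
    ((integrable_inv_pow_sub_I_mul ha m).const_mul _)
    (tendsto_inv_pow_sub_I_mul a m tendsto_abs_atBot_atTop)
    (tendsto_inv_pow_sub_I_mul a m tendsto_abs_atTop_atTop)
  rw [integral_const_mul, sub_zero] at h
  exact (mul_eq_zero.1 h).resolve_left hm

theorem integrable_inv_pow_mul_inv (ha : 0 < a) (m : ℕ) :
    Integrable fun t : ℝ =>
      (((a : ℂ) - Complex.I * t) ^ (m + 1))⁻¹ * ((a : ℂ) + Complex.I * t)⁻¹ := by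
  refine ((integrable_inv_sq_add_sq ha).const_mul (a ^ m)⁻¹).mono'
    ((continuous_inv_pow_sub_I_mul ha _).mul (Continuous.inv₀ (by fun_prop)
      (add_I_mul_ne_zero ha))).aestronglyMeasurable (ae_of_all _ fun t => ?_)
  rw [norm_mul, norm_inv ((a : ℂ) + _), norm_add_I_mul, ← norm_inv, ← norm_mul, ← mul_inv,
    ← pow_succ]
  exact norm_inv_pow_sub_I_mul_le ha m t

theorem integral_inv_pow_mul_inv (ha : 0 < a) (m : ℕ) :
    ∫ t : ℝ, (((a : ℂ) - Complex.I * t) ^ (m + 1))⁻¹ * ((a : ℂ) + Complex.I * t)⁻¹ =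
      ((2 * Real.pi * ((2 * a) ^ (m + 1))⁻¹ : ℝ) : ℂ) := by
  induction m with
  | zero =>
    have hreal (t : ℝ) : (((a : ℂ) - Complex.I * t) ^ (0 + 1))⁻¹ * ((a : ℂ) + Complex.I * t)⁻¹ =
        (((a ^ 2 + t ^ 2)⁻¹ : ℝ) : ℂ) := by
      rw [zero_add, pow_one, ← mul_inv, sub_I_mul_mul_add, Complex.ofReal_inv]
    simp only [hreal]
    rw [integral_complex_ofReal, integral_inv_sq_add_sq ha, zero_add, pow_one]
    congr 1
    field_simp
  | succ m ih =>
    have ha' : (a : ℂ) ≠ 0 := Complex.ofReal_ne_zero.2 ha.ne'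
    have hsplit (t : ℝ) :
        (((a : ℂ) - Complex.I * t) ^ (m + 1 + 1))⁻¹ * ((a : ℂ) + Complex.I * t)⁻¹ =
        (2 * a : ℂ)⁻¹ * ((((a : ℂ) - Complex.I * t) ^ (m + 1))⁻¹ * ((a : ℂ) + Complex.I * t)⁻¹ +
          (((a : ℂ) - Complex.I * t) ^ (m + 2))⁻¹) := by
      have h1 := sub_I_mul_ne_zero ha t
      have h2 := add_I_mul_ne_zero ha t
      field_simp
      ring
    simp only [hsplit]
    rw [integral_const_mul, integral_add (integrable_inv_pow_mul_inv ha m)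
      (integrable_inv_pow_sub_I_mul ha m), ih, integral_inv_pow_sub_I_mul ha, add_zero]
    push_cast
    rw [pow_succ (2 * (a : ℂ)) (m + 1), mul_inv]
    ring

end RationalIntegrals

section GaussianIntegrals

theorem exp_neg_mul_sum (lam : Fin n → ℝ) (r : ℝ) (w : Fin n → ℂ) :
    Real.exp (-(r * ∑ j, lam j * ‖w j‖ ^ 2)) = ∏ j, Real.exp (-(r * lam j) * ‖w j‖ ^ 2) := by
  rw [← Real.exp_sum, Finset.mul_sum, ← Finset.sum_neg_distrib]
  simp only [neg_mul, mul_assoc]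

variable {lam : Fin n → ℝ} {a r : ℝ}

theorem integral_exp_neg_mul_sum (hlam : ∀ j, 0 < lam j) (hr : 0 < r) :
    ∫ w : Fin n → ℂ, Real.exp (-(r * ∑ j, lam j * ‖w j‖ ^ 2)) =
      Real.pi ^ n / (r ^ n * ∏ j, lam j) := by
  have hgauss {b : ℝ} (hb : 0 < b) : ∫ z : ℂ, Real.exp (-b * ‖z‖ ^ 2) = Real.pi / b := by
    simpa using GaussianFourier.integral_rexp_neg_mul_sq_norm (V := ℂ) hb
  simp only [exp_neg_mul_sum]
  rw [integral_fintype_prod_volume_eq_prod (fun j (z : ℂ) => Real.exp (-(r * lam j) * ‖z‖ ^ 2))]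
  simp only [hgauss (mul_pos hr (hlam _))]
  simp [Finset.prod_div_distrib, Finset.prod_mul_distrib]

theorem integrable_exp_neg_mul_sum (hlam : ∀ j, 0 < lam j) (hr : 0 < r) :
    Integrable fun w : Fin n → ℂ => Real.exp (-(r * ∑ j, lam j * ‖w j‖ ^ 2)) := by
  refine Integrable.of_integral_ne_zero ?_
  rw [integral_exp_neg_mul_sum hlam hr]
  have := Finset.prod_pos fun j (_ : j ∈ Finset.univ) => hlam j
  positivity

theorem integral_pow_mul_exp_neg (m : ℕ) (ha : 0 < a) :
    ∫ r in Set.Ioi (0 : ℝ), r ^ m * Real.exp (-(a * r)) = m.factorial * (a ^ (m + 1))⁻¹ := by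
  have h := Real.integral_rpow_mul_exp_neg_mul_Ioi (a := m + 1) (by positivity) ha
  rw [Real.Gamma_nat_eq_factorial, add_sub_cancel_right] at h
  simp only [Real.rpow_natCast] at h
  rw [h, mul_comm, ← Nat.cast_add_one, Real.rpow_natCast, one_div, inv_pow]

theorem add_sum_pos (hlam : ∀ j, 0 < lam j) (ha : 0 < a) (w : Fin n → ℂ) :
    0 < a + ∑ j, lam j * ‖w j‖ ^ 2 :=
  add_pos_of_pos_of_nonneg ha (Finset.sum_nonneg fun j _ => mul_nonneg (hlam j).le (sq_nonneg _))

theorem pow_mul_exp_neg_add_sum (lam : Fin n → ℝ) (a r : ℝ) (w : Fin n → ℂ) :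
    r ^ n * Real.exp (-((a + ∑ j, lam j * ‖w j‖ ^ 2) * r)) =
      r ^ n * Real.exp (-(a * r)) * Real.exp (-(r * ∑ j, lam j * ‖w j‖ ^ 2)) := by
  rw [mul_assoc, ← Real.exp_add]
  congr 2
  ring

theorem integral_pow_mul_exp_neg_add_sum (hlam : ∀ j, 0 < lam j) (a : ℝ) (hr : 0 < r) :
    ∫ w : Fin n → ℂ, r ^ n * Real.exp (-((a + ∑ j, lam j * ‖w j‖ ^ 2) * r)) =
      (Real.pi ^ n / ∏ j, lam j) * Real.exp (-a * r) := by
  simp only [pow_mul_exp_neg_add_sum]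
  rw [integral_const_mul, integral_exp_neg_mul_sum hlam hr, neg_mul]
  field_simp

theorem integrable_pow_mul_exp_neg_add_sum (hlam : ∀ j, 0 < lam j) (ha : 0 < a) :
    Integrable (fun p : (Fin n → ℂ) × ℝ =>
      p.2 ^ n * Real.exp (-((a + ∑ j, lam j * ‖p.1 j‖ ^ 2) * p.2)))
      ((volume : Measure (Fin n → ℂ)).prod (volume.restrict (Set.Ioi 0))) := by
  rw [integrable_prod_iff' (by fun_prop)]
  constructor
  · refine (ae_restrict_iff' measurableSet_Ioi).2 (ae_of_all _ fun r hr => ?_)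
    simp only [pow_mul_exp_neg_add_sum]
    exact (integrable_exp_neg_mul_sum hlam hr).const_mul _
  · have hexp : IntegrableOn (fun r : ℝ => (Real.pi ^ n / ∏ j, lam j) * Real.exp (-a * r))
        (Set.Ioi 0) := (integrableOn_exp_mul_Ioi (neg_neg_of_pos ha) 0).const_mul _
    refine hexp.congr_fun (fun r hr => ?_) measurableSet_Ioi
    simp only [norm_mul, norm_pow, Real.norm_eq_abs, Real.abs_exp, abs_of_pos (Set.mem_Ioi.1 hr)]
    exact (integral_pow_mul_exp_neg_add_sum hlam a hr).symm

theorem integral_inv_pow_add_sum (hlam : ∀ j, 0 < lam j) (ha : 0 < a) :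
    ∫ w : Fin n → ℂ, ((a + ∑ j, lam j * ‖w j‖ ^ 2) ^ (n + 1))⁻¹ =
      Real.pi ^ n / (n.factorial * (∏ j, lam j) * a) := by
  have hprod := Finset.prod_pos fun j (_ : j ∈ Finset.univ) => hlam j
  have hlaplace (w : Fin n → ℂ) : ((a + ∑ j, lam j * ‖w j‖ ^ 2) ^ (n + 1))⁻¹ =
      (n.factorial : ℝ)⁻¹ * ∫ r in Set.Ioi (0 : ℝ),
        r ^ n * Real.exp (-((a + ∑ j, lam j * ‖w j‖ ^ 2) * r)) := by
    rw [integral_pow_mul_exp_neg n (add_sum_pos hlam ha w), inv_mul_cancel_left₀ (by positivity)]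
  simp only [hlaplace]
  rw [integral_const_mul, integral_integral_swap (integrable_pow_mul_exp_neg_add_sum hlam ha),
    setIntegral_congr_fun measurableSet_Ioi
      (fun r hr => integral_pow_mul_exp_neg_add_sum hlam a hr),
    integral_const_mul, integral_exp_mul_Ioi (neg_neg_of_pos ha)]
  simp only [mul_zero, Real.exp_zero]
  field_simp

theorem integrable_inv_pow_add_sum (hlam : ∀ j, 0 < lam j) (ha : 0 < a) :
    Integrable fun w : Fin n → ℂ => ((a + ∑ j, lam j * ‖w j‖ ^ 2) ^ (n + 1))⁻¹ := by
  refine Integrable.of_integral_ne_zero ?_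
  rw [integral_inv_pow_add_sum hlam ha]
  have := Finset.prod_pos fun j (_ : j ∈ Finset.univ) => hlam j
  positivity

end GaussianIntegrals

/-! ### The Szegő and Poisson kernels -/

/-- The CR function whose translates are the regularized kernels of the theorem, up to
conjugation. -/
def szegoKernel (lam : Fin n → ℝ) (ε : ℝ) (v : Heis n) : ℂ := ((gauge lam v + ε) ^ (n + 1))⁻¹

/-- The Poisson–Szegő kernel `2ε |g + ε|⁻² (conj g + ε)⁻ⁿ`, with `g` the gauge; for `ε → 0` it is
an approximate identity, up to a constant factor. -/
def poissonKernel (lam : Fin n → ℝ) (ε : ℝ) (v : Heis n) : ℂ :=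
  2 * ε * ((conj (gauge lam v) + ε) ^ (n + 1))⁻¹ * (gauge lam v + ε)⁻¹

/-- The `j`-th coefficient of the form whose `Z̄`-divergence is a multiple of the difference between
the Poisson kernel and the conjugate Szegő kernel. -/
def primitiveKernel (lam : Fin n → ℝ) (ε : ℝ) (j : Fin n) (v : Heis n) : ℂ :=
  conj (v.1 j) * (((conj (gauge lam v) + ε) ^ n)⁻¹ * (gauge lam v + ε)⁻¹)

theorem integrable_heisVol_iff {E : Type*} [NormedAddCommGroup E] {F : Heis n → E} :
    Integrable F (heisVol n) ↔ Integrable F ((volume : Measure (Fin n → ℂ)).prod volume) := by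
  refine ⟨fun h => ?_, fun h => h.smul_measure_nnreal⟩
  have h' := h.smul_measure_nnreal (c := ((2 : ℝ≥0) ^ n)⁻¹)
  rwa [heisVol, smul_smul, inv_mul_cancel₀ (by positivity), one_smul] at h'

theorem integral_heisVol {E : Type*} [NormedAddCommGroup E] [NormedSpace ℝ E] {F : Heis n → E}
    (hF : Integrable F (heisVol n)) :
    ∫ v, F v ∂heisVol n = (2 : ℝ) ^ n • ∫ w : Fin n → ℂ, ∫ t : ℝ, F (w, t) := by
  rw [← integral_prod _ (integrable_heisVol_iff.1 hF), heisVol, integral_smul_nnreal_measure,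
    NNReal.smul_def]
  rfl

section Kernels

variable {lam : Fin n → ℝ} (hlam : ∀ j, 0 < lam j) {ε : ℝ} (hε : 0 < ε)
include hlam hε

theorem contDiff_szegoKernel : ContDiff ℝ ∞ (szegoKernel lam ε) :=
  (((contDiff_gauge lam).add contDiff_const).pow _).inv
    fun v => pow_ne_zero _ (gauge_add_ne_zero hlam hε v)

theorem contDiff_primitiveKernel (j : Fin n) : ContDiff ℝ ∞ (primitiveKernel lam ε j) :=
  (contDiff_conj_coord j).mul
    (((((contDiff_conj_gauge lam).add contDiff_const).pow _).inv
      fun v => pow_ne_zero _ (conj_gauge_add_ne_zero hlam hε v)).mul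
    (((contDiff_gauge lam).add contDiff_const).inv (gauge_add_ne_zero hlam hε)))

theorem continuous_poissonKernel : Continuous (poissonKernel lam ε) := by
  have hg := (contDiff_gauge lam).continuous
  have hcg := (contDiff_conj_gauge lam).continuous
  exact (continuous_const.mul (((hcg.add continuous_const).pow _).inv₀
    fun v => pow_ne_zero _ (conj_gauge_add_ne_zero hlam hε v))).mul
    ((hg.add continuous_const).inv₀ (gauge_add_ne_zero hlam hε))

theorem Zbar_szegoKernel (j : Fin n) (v : Heis n) : Zbar lam j (szegoKernel lam ε) v = 0 := by
  have hg := (contDiff_gauge lam).contDiffAt.differentiableAt (x := v) (by simp)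
  refine (Zbar_inv_pow lam j (n + 1) (gauge_add_ne_zero hlam hε v) (hg.add_const _)).trans ?_
  rw [Zbar_add lam j hg (differentiableAt_const _), Zbar_gauge, Zbar_const, add_zero,
    mul_zero]

theorem Zbar_primitiveKernel (j : Fin n) (v : Heis n) :
    Zbar lam j (primitiveKernel lam ε j) v =
      ((conj (gauge lam v) + ε) ^ (n + 1))⁻¹ * (gauge lam v + ε)⁻¹ *
        (conj (gauge lam v) + ε - 2 * n * (lam j * (conj (v.1 j) * v.1 j))) := by
  have hne := gauge_add_ne_zero hlam hε v
  have hne' := conj_gauge_add_ne_zero hlam hε v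
  have hg := (contDiff_gauge lam).contDiffAt.differentiableAt (x := v) (by simp)
  have hg' := (contDiff_conj_gauge lam).contDiffAt.differentiableAt (x := v) (by simp)
  have hc := (contDiff_conj_coord j).contDiffAt.differentiableAt (x := v) (by simp)
  have hinv := (hg.add_const (ε : ℂ)).fun_inv hne
  have hpow := ((hg'.add_const (ε : ℂ)).fun_pow n).fun_inv (pow_ne_zero _ hne')
  refine (Zbar_mul lam j hc (hpow.fun_mul hinv)).trans ?_
  rw [Zbar_mul lam j hpow hinv, Zbar_inv lam j hne (hg.add_const _),
    Zbar_inv_pow lam j n hne' (hg'.add_const _), Zbar_add lam j hg (differentiableAt_const _),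
    Zbar_add lam j hg' (differentiableAt_const _), Zbar_gauge, Zbar_conj_gauge, Zbar_const,
    Zbar_conj_coord, if_pos rfl, pow_succ]
  field_simp
  ring

theorem sum_Zbar_primitiveKernel (v : Heis n) :
    ∑ j, Zbar lam j (primitiveKernel lam ε j) v =
      n * (poissonKernel lam ε v - conj (szegoKernel lam ε v)) := by
  have hne := gauge_add_ne_zero hlam hε v
  have hnum : (n : ℂ) * (conj (gauge lam v) + ε)
      - 2 * n * ∑ j, (lam j : ℂ) * (conj (v.1 j) * v.1 j) =
      n * (2 * ε - (gauge lam v + ε)) := by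
    linear_combination (n : ℂ) * gauge_add_conj_gauge lam v
  simp only [Zbar_primitiveKernel hlam hε, ← Finset.mul_sum, Finset.sum_sub_distrib,
    Finset.sum_const, Finset.card_univ, Fintype.card_fin, nsmul_eq_mul]
  rw [hnum, szegoKernel, poissonKernel, map_inv₀, map_pow, map_add, Complex.conj_ofReal]
  field_simp

/-! ### Integrability of the kernels -/

omit hlam hε in
theorem gauge_add_eq (lam : Fin n → ℝ) (ε : ℝ) (v : Heis n) :
    gauge lam v + ε = ((ε + ∑ j, lam j * ‖v.1 j‖ ^ 2 : ℝ) : ℂ) + Complex.I * v.2 := by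
  rw [gauge, Complex.ofReal_add]
  ring

omit hlam hε in
theorem conj_gauge_add_eq (lam : Fin n → ℝ) (ε : ℝ) (v : Heis n) :
    conj (gauge lam v) + ε = ((ε + ∑ j, lam j * ‖v.1 j‖ ^ 2 : ℝ) : ℂ) - Complex.I * v.2 := by
  simp only [gauge, map_add, map_mul, Complex.conj_ofReal, Complex.conj_I, Complex.ofReal_add]
  ring

omit hε in
theorem le_norm_gauge_add (ε : ℝ) (v : Heis n) : ε ≤ ‖gauge lam v + ε‖ := by
  refine le_trans ?_ (Complex.re_le_norm _)
  simpa using gauge_re_nonneg hlam v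

omit hlam hε in
theorem norm_conj_gauge_add (lam : Fin n → ℝ) (ε : ℝ) (v : Heis n) :
    ‖conj (gauge lam v) + ε‖ = ‖gauge lam v + ε‖ := by
  rw [← RCLike.norm_conj (gauge lam v + ε), map_add, Complex.conj_ofReal]

theorem mul_norm_sq_le_norm_gauge_add (v : Heis n) (j : Fin n) :
    lam j * ‖v.1 j‖ ^ 2 ≤ ‖gauge lam v + ε‖ := by
  have hle : lam j * ‖v.1 j‖ ^ 2 ≤ ∑ k, lam k * ‖v.1 k‖ ^ 2 :=
    Finset.single_le_sum (f := fun k => lam k * ‖v.1 k‖ ^ 2)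
      (fun k _ => mul_nonneg (hlam k).le (sq_nonneg _)) (Finset.mem_univ j)
  refine le_trans ?_ (Complex.re_le_norm _)
  rw [Complex.add_re, gauge_re, Complex.ofReal_re]
  linarith

theorem continuous_inv_norm_gauge_add_pow (m : ℕ) :
    Continuous fun v => (‖gauge lam v + ε‖ ^ m)⁻¹ :=
  (((contDiff_gauge lam).continuous.add continuous_const).norm.pow _).inv₀ fun v =>
    pow_ne_zero _ (norm_ne_zero_iff.2 (gauge_add_ne_zero hlam hε v))

theorem integrable_inv_norm_gauge_add_pow {m : ℕ} (hm : n + 2 ≤ m) :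
    Integrable (fun v => (‖gauge lam v + ε‖ ^ m)⁻¹) (heisVol n) := by
  obtain ⟨k, rfl⟩ := Nat.exists_eq_add_of_le' hm
  have hprod := integrable_prod_inv_pow_mul_inv_sq_add_sq
    (A := fun w : Fin n → ℂ => ε + ∑ j, lam j * ‖w j‖ ^ 2) (by fun_prop) (add_sum_pos hlam hε)
    (integrable_inv_pow_add_sum hlam hε)
  refine ((integrable_heisVol_iff.2 hprod).const_mul (ε ^ k)⁻¹).mono'
    (continuous_inv_norm_gauge_add_pow hlam hε _).aestronglyMeasurable (ae_of_all _ fun v => ?_)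
  have hcrit := norm_inv_pow_sub_I_mul_le (add_sum_pos hlam hε v.1) n v.2
  rw [norm_inv, norm_pow, ← norm_add_I_mul, ← gauge_add_eq] at hcrit
  have hle := le_norm_gauge_add hlam ε v
  rw [Real.norm_of_nonneg (by positivity), pow_add, mul_inv]
  gcongr

theorem memLp_two_of_norm_sq_le (hn : 1 ≤ n) {F : Heis n → ℂ} (hF : Continuous F) (C : ℝ)
    (h : ∀ v, ‖F v‖ ^ 2 ≤ C * (‖gauge lam v + ε‖ ^ (2 * n + 1))⁻¹) : MemLp F 2 (heisVol n) := by
  rw [memLp_two_iff_integrable_sq_norm hF.aestronglyMeasurable]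
  refine ((integrable_inv_norm_gauge_add_pow hlam hε (m := 2 * n + 1) (by omega)).const_mul C).mono'
    (hF.norm.pow 2).aestronglyMeasurable (ae_of_all _ fun v => ?_)
  rw [Real.norm_of_nonneg (by positivity)]
  exact h v

theorem inv_norm_gauge_add_pow_succ_le (m : ℕ) (v : Heis n) :
    (‖gauge lam v + ε‖ ^ (m + 1))⁻¹ ≤ ε⁻¹ * (‖gauge lam v + ε‖ ^ m)⁻¹ := by
  have := le_norm_gauge_add hlam ε v
  rw [pow_succ, mul_inv, mul_comm]
  gcongr

theorem memLp_szegoKernel (hn : 1 ≤ n) : MemLp (szegoKernel lam ε) 2 (heisVol n) := by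
  refine memLp_two_of_norm_sq_le hlam hε hn (contDiff_szegoKernel hlam hε).continuous ε⁻¹
    fun v => ?_
  rw [szegoKernel, norm_inv, norm_pow, inv_pow, ← pow_mul,
    show (n + 1) * 2 = 2 * n + 1 + 1 by ring]
  exact inv_norm_gauge_add_pow_succ_le hlam hε (2 * n + 1) v

theorem memLp_primitiveKernel (hn : 1 ≤ n) (j : Fin n) :
    MemLp (primitiveKernel lam ε j) 2 (heisVol n) := by
  refine memLp_two_of_norm_sq_le hlam hε hn (contDiff_primitiveKernel hlam hε j).continuous
    (lam j)⁻¹ fun v => ?_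
  have hpos : 0 < ‖gauge lam v + ε‖ := hε.trans_le (le_norm_gauge_add hlam ε v)
  have hcoord := mul_norm_sq_le_norm_gauge_add hlam hε v j
  rw [← le_inv_mul_iff₀ (hlam j)] at hcoord
  rw [primitiveKernel, norm_mul, norm_mul, norm_inv, norm_inv, norm_pow, RCLike.norm_conj,
    norm_conj_gauge_add]
  set N := ‖gauge lam v + ε‖
  calc (‖v.1 j‖ * ((N ^ n)⁻¹ * N⁻¹)) ^ 2
      = ‖v.1 j‖ ^ 2 * (N ^ (2 * n + 2))⁻¹ := by ring
    _ ≤ (lam j)⁻¹ * N * (N ^ (2 * n + 2))⁻¹ := by gcongr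
    _ = (lam j)⁻¹ * (N ^ (2 * n + 1))⁻¹ := by
        field_simp
        ring

theorem memLp_Zbar_primitiveKernel (hn : 1 ≤ n) (j : Fin n) :
    MemLp (Zbar lam j (primitiveKernel lam ε j)) 2 (heisVol n) := by
  refine memLp_two_of_norm_sq_le hlam hε hn
    (contDiff_Zbar lam j (contDiff_primitiveKernel hlam hε j)).continuous
    ((1 + 2 * n) ^ 2 * ε⁻¹) fun v => ?_
  have hpos : 0 < ‖gauge lam v + ε‖ := hε.trans_le (le_norm_gauge_add hlam ε v)
  have hcoord := mul_norm_sq_le_norm_gauge_add hlam hε v j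
  have hfactor : ‖conj (gauge lam v) + ε - 2 * n * (lam j * (conj (v.1 j) * v.1 j))‖ ≤
      (1 + 2 * n) * ‖gauge lam v + ε‖ := by
    refine (norm_sub_le _ _).trans ?_
    simp only [norm_conj_gauge_add, norm_mul, RCLike.norm_conj, Complex.norm_real,
      Real.norm_of_nonneg (hlam j).le, ← sq, Complex.norm_ofNat, RCLike.norm_natCast]
    nlinarith [(n.cast_nonneg : (0 : ℝ) ≤ n)]
  have hpow := inv_norm_gauge_add_pow_succ_le hlam hε (2 * n + 1) v
  rw [Zbar_primitiveKernel hlam hε, norm_mul, norm_mul, norm_inv, norm_inv, norm_pow,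
    norm_conj_gauge_add]
  set N := ‖gauge lam v + ε‖
  calc _ ≤ ((N ^ (n + 1))⁻¹ * N⁻¹ * ((1 + 2 * n) * N)) ^ 2 := by gcongr
    _ = (1 + 2 * n) ^ 2 * (N ^ (2 * n + 1 + 1))⁻¹ := by
        field_simp
        ring
    _ ≤ (1 + 2 * n) ^ 2 * (ε⁻¹ * (N ^ (2 * n + 1))⁻¹) := by gcongr
    _ = _ := by ring

theorem integrable_poissonKernel : Integrable (poissonKernel lam ε) (heisVol n) := by
  refine ((integrable_inv_norm_gauge_add_pow hlam hε le_rfl).const_mul (2 * ε)).mono'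
    (continuous_poissonKernel hlam hε).aestronglyMeasurable (ae_of_all _ fun v => le_of_eq ?_)
  simp only [poissonKernel, norm_mul, norm_inv, norm_pow, norm_conj_gauge_add,
    Complex.norm_ofNat, Complex.norm_real, Real.norm_of_nonneg hε.le]
  rw [mul_assoc, ← mul_inv, ← pow_succ]

theorem integral_poissonKernel :
    ∫ v, poissonKernel lam ε v ∂heisVol n =
      ((2 * Real.pi ^ (n + 1) / (n.factorial * ∏ j, lam j) : ℝ) : ℂ) := by
  have hprod := Finset.prod_pos fun j (_ : j ∈ Finset.univ) => hlam j
  have hinner (w : Fin n → ℂ) : ∫ t : ℝ, poissonKernel lam ε (w, t) =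
      ((2 * ε * (2 * Real.pi * (2 ^ (n + 1))⁻¹) *
        ((ε + ∑ j, lam j * ‖w j‖ ^ 2) ^ (n + 1))⁻¹ : ℝ) : ℂ) := by
    simp only [poissonKernel, gauge_add_eq, conj_gauge_add_eq, mul_assoc]
    rw [integral_const_mul, integral_const_mul, integral_inv_pow_mul_inv (add_sum_pos hlam hε w),
      mul_pow, mul_inv]
    push_cast
    ring
  rw [integral_heisVol (integrable_poissonKernel hlam hε)]
  simp only [hinner]
  rw [integral_complex_ofReal, integral_const_mul, integral_inv_pow_add_sum hlam hε,
    Complex.real_smul, ← Complex.ofReal_mul]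
  congr 1
  field_simp
  ring

end Kernels

/-! ### The mean value property -/

theorem IsWeakDbar.integral_mul_conj_szegoKernel (hn : 1 ≤ n) {lam : Fin n → ℝ}
    (hlam : ∀ j, 0 < lam j) {ε : ℝ} (hε : 0 < ε) {f : Heis n → ℂ} (hf : MemLp f 2 (heisVol n))
    (h : IsWeakDbar lam f (fun _ => 0)) :
    ∫ v, f v * conj (szegoKernel lam ε v) ∂heisVol n =
      ∫ v, f v * poissonKernel lam ε v ∂heisVol n := by
  have hZ (j : Fin n) := memLp_Zbar_primitiveKernel hlam hε hn j
  have hsum : ∫ v, f v * ∑ j, Zbar lam j (primitiveKernel lam ε j) v ∂heisVol n = 0 := by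
    have hint (j : Fin n) : Integrable (fun v => f v * Zbar lam j (primitiveKernel lam ε j) v)
        (heisVol n) := hf.integrable_mul (hZ j)
    simp only [Finset.mul_sum]
    rw [integral_finsetSum _ fun j _ => hint j]
    exact Finset.sum_eq_zero fun j _ => h.integral_mul_Zbar hf j
      (contDiff_primitiveKernel hlam hε j) (memLp_primitiveKernel hlam hε hn j) (hZ j)
  have hZint : Integrable (fun v => f v * ∑ j, Zbar lam j (primitiveKernel lam ε j) v)
      (heisVol n) := hf.integrable_mul (memLp_finsetSum _ fun j _ => hZ j)
  have hkint : Integrable (fun v => f v * conj (szegoKernel lam ε v)) (heisVol n) :=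
    hf.integrable_mul (memLp_szegoKernel hlam hε hn).star
  have hn0 : (n : ℂ) ≠ 0 := Nat.cast_ne_zero.2 (by omega)
  calc ∫ v, f v * conj (szegoKernel lam ε v) ∂heisVol n
      = ∫ v, f v * conj (szegoKernel lam ε v) ∂heisVol n +
          (n : ℂ)⁻¹ * ∫ v, f v * ∑ j, Zbar lam j (primitiveKernel lam ε j) v ∂heisVol n := by
        rw [hsum, mul_zero, add_zero]
    _ = ∫ v, f v * poissonKernel lam ε v ∂heisVol n := by
        rw [← integral_const_mul, ← integral_add hkint (hZint.const_mul _)]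
        congr 1 with v
        rw [sum_Zbar_primitiveKernel hlam hε]
        field_simp
        ring

theorem integral_conj_szegoKernel_mul (hn : 1 ≤ n) {lam : Fin n → ℝ} (hlam : ∀ j, 0 < lam j)
    {ε : ℝ} (hε : 0 < ε) (y : Heis n) (g : L2Fun n) :
    ∫ x, conj (szegoKernel lam ε (mul lam (-y) x)) * g x ∂heisVol n =
      ∫ v, szegoProjection lam g (mul lam y v) * poissonKernel lam ε v ∂heisVol n := by
  have hk : MemLp (fun x => szegoKernel lam ε (mul lam (-y) x)) 2 (heisVol n) :=
    (memLp_szegoKernel hlam hε hn).comp_measurePreserving (measurePreserving_mul_left lam (-y))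
  set K : L2Fun n := hk.toLp _
  have hcr : IsWeakDbar lam (szegoKernel lam ε) (fun _ => 0) :=
    isWeakDbar_zero_of_Zbar_eq_zero (contDiff_szegoKernel hlam hε) (Zbar_szegoKernel hlam hε)
  have hK : K ∈ kerKohn lam := mem_kerKohn_iff.2
    (isWeakDbar_congr lam hk.coeFn_toLp.symm (ae_eq_refl _) (hcr.comp_mul_left (-y)))
  have hinner (g : L2Fun n) :
      ⟪K, g⟫_ℂ = ∫ x, conj (szegoKernel lam ε (mul lam (-y) x)) * g x ∂heisVol n := by
    rw [L2.inner_def]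
    refine integral_congr_ae ?_
    filter_upwards [hk.coeFn_toLp] with x hx
    rw [hx, RCLike.inner_apply, mul_comm]
  have hproj : ⟪K, szegoProjection lam g⟫_ℂ = ⟪K, g⟫_ℂ := by
    rw [szegoProjection, ← Submodule.inner_starProjection_left_eq_right,
      Submodule.starProjection_eq_self_iff.2 hK]
  have hPg : IsWeakDbar lam (szegoProjection lam g) (fun _ => 0) :=
    mem_kerKohn_iff.1 ((kerKohn lam).starProjection_apply_mem g)
  have hmem : MemLp (fun v => szegoProjection lam g (mul lam y v)) 2 (heisVol n) :=
    (Lp.memLp _).comp_measurePreserving (measurePreserving_mul_left lam y)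
  rw [← hinner, ← hproj, hinner, ← integral_mul_left lam y,
    ← (hPg.comp_mul_left y).integral_mul_conj_szegoKernel hn hlam hε hmem]
  simp only [mul_neg_mul, mul_comm]

/-! ### The limit of the regularized integrals -/

section LogPrimitive

/-- A primitive of the logarithm on the right half-plane; unlike the logarithm itself, it is
continuous up to the boundary. -/
def logPrimitive (a : ℂ) : ℂ := a * Complex.log a - a

theorem mem_slitPlane_of_re_pos {a : ℂ} (ha : 0 < a.re) : a ∈ Complex.slitPlane :=
  Complex.mem_slitPlane_iff.2 (Or.inl ha)

theorem norm_mul_log_le (a : ℂ) :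
    ‖a * Complex.log a‖ ≤ |‖a‖ * Real.log ‖a‖| + Real.pi * ‖a‖ := by
  have h : ‖Complex.log a‖ ≤ |Real.log ‖a‖| + Real.pi := by
    refine (Complex.norm_le_abs_re_add_abs_im _).trans ?_
    rw [Complex.log_re, Complex.log_im]
    gcongr
    exact Complex.abs_arg_le_pi a
  rw [norm_mul, abs_mul, abs_norm]
  calc ‖a‖ * ‖Complex.log a‖ ≤ ‖a‖ * (|Real.log ‖a‖| + Real.pi) := by gcongr
    _ = _ := by ring

theorem tendsto_mul_log_zero : Tendsto (fun a : ℂ => a * Complex.log a) (𝓝 0) (𝓝 0) := by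
  have h : Continuous fun a : ℂ => |‖a‖ * Real.log ‖a‖| + Real.pi * ‖a‖ :=
    (Real.continuous_mul_log.comp continuous_norm).abs.add (continuous_const.mul continuous_norm)
  exact squeeze_zero_norm norm_mul_log_le (by simpa using h.tendsto 0)

theorem continuousOn_logPrimitive : ContinuousOn logPrimitive {a | 0 ≤ a.re} := by
  intro a ha
  refine (ContinuousAt.sub ?_ continuousAt_id).continuousWithinAt
  rcases eq_or_ne a 0 with rfl | h0
  · simpa only [ContinuousAt, zero_mul] using tendsto_mul_log_zero
  · have hs : a ∈ Complex.slitPlane := Complex.mem_slitPlane_iff.2 <|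
      (ha : 0 ≤ a.re).lt_or_eq.imp_right fun hre him => h0 (Complex.ext hre.symm him)
    exact continuousAt_id.mul (continuousAt_clog hs)

theorem hasDerivAt_logPrimitive {a : ℂ} (ha : 0 < a.re) :
    HasDerivAt logPrimitive (Complex.log a) a := by
  have hs := mem_slitPlane_of_re_pos ha
  have h0 : a ≠ 0 := Complex.slitPlane_ne_zero hs
  convert! ((hasDerivAt_id' a).mul (Complex.hasDerivAt_log hs)).sub (hasDerivAt_id' a) using 1
  field_simp
  ring

theorem hasDerivAt_inv_pow (m : ℕ) {a : ℂ} (ha : a ≠ 0) :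
    HasDerivAt (fun a : ℂ => (a ^ (m + 1))⁻¹) (-(m + 1 : ℂ) * (a ^ (m + 2))⁻¹) a := by
  convert! ((hasDerivAt_id' a).fun_pow (m + 1)).inv (pow_ne_zero _ ha) using 1
  simp only [Nat.add_sub_cancel]
  push_cast
  field_simp
  ring

end LogPrimitive

section IntegrationByParts

theorem IsTest.dt {u : Heis n → ℂ} (hu : IsTest u) : IsTest (dt u) := hu.fderiv_apply _

theorem IsTest.iterate_dt {u : Heis n → ℂ} (hu : IsTest u) (m : ℕ) :
    IsTest (Heisenberg.dt^[m] u) :=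
  Function.Iterate.rec _ hu (fun _ => IsTest.dt) m

variable {q : Heis n → ℂ} (hq : Differentiable ℝ q) (hqt : ∀ y, dt q y = -Complex.I)
  (hpos : ∀ y, 0 < (q y).re) {u : Heis n → ℂ}
include hq hqt hpos

theorem integral_deriv_comp_mul {g g' : ℂ → ℂ}
    (hg : ∀ a : ℂ, 0 < a.re → HasDerivAt g (g' a) a) (hg' : ContinuousOn g' {a | 0 < a.re})
    (hu : IsTest u) :
    ∫ y, g' (q y) * u y ∂heisVol n = -Complex.I * ∫ y, g (q y) * dt u y ∂heisVol n := by
  have hd (y : Heis n) : HasFDerivAt (fun y => g (q y)) _ y :=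
    ((hg _ (hpos y)).hasFDerivAt.restrictScalars ℝ).comp y (hq y).hasFDerivAt
  have hdt (y : Heis n) : fderiv ℝ (fun y => g (q y)) y (0, 1) = -Complex.I * g' (q y) := by
    have := hqt y
    rw [Heisenberg.dt] at this
    rw [(hd y).fderiv]
    simp [this]
  have hgq : Continuous fun y => g (q y) :=
    continuous_iff_continuousAt.2 fun y => (hd y).continuousAt
  have hgq' : Continuous fun y => g' (q y) := hg'.comp_continuous hq.continuous hpos
  have hint {f v : Heis n → ℂ} (hf : Continuous f) (hv : IsTest v) :
      Integrable (fun y => f y * v y) :=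
    (hf.mul hv.1.continuous).integrable_of_hasCompactSupport hv.2.mul_left
  have hparts := integral_mul_fderiv_eq_neg_fderiv_mul_of_integrable
    (f := fun y => g (q y)) (g := u) (v := ((0, 1) : Heis n))
    (μ := (volume : Measure (Heis n)))
    (by simp only [hdt]; exact hint (continuous_const.mul hgq') hu)
    (hint hgq hu.dt) (hint hgq hu) (fun y _ => (hd y).differentiableAt)
    (fun y _ => hu.1.contDiffAt.differentiableAt (by simp))
  simp only [hdt, mul_assoc, integral_const_mul] at hparts
  rw [integral_smul_nnreal_measure, integral_smul_nnreal_measure]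
  simp only [Heisenberg.dt]
  rw [hparts, mul_smul_comm]
  congr 1
  linear_combination (∫ y, g' (q y) * u y) * Complex.I_sq

theorem integral_inv_pow_comp_mul (m : ℕ) (hu : IsTest u) :
    ∫ y, (q y ^ (m + 1))⁻¹ * u y ∂heisVol n =
      -(Complex.I ^ m / m.factorial) * ∫ y, logPrimitive (q y) * dt^[m + 2] u y ∂heisVol n := by
  have hne (a : ℂ) (ha : 0 < a.re) : a ≠ 0 := Complex.slitPlane_ne_zero (mem_slitPlane_of_re_pos ha)
  induction m generalizing u with
  | zero =>
    have hlog := integral_deriv_comp_mul hq hqt hpos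
      (fun a ha => Complex.hasDerivAt_log (mem_slitPlane_of_re_pos ha))
      (continuousOn_inv₀.mono hne) hu
    have hprim := integral_deriv_comp_mul hq hqt hpos (fun a => hasDerivAt_logPrimitive)
      (fun a ha => (continuousAt_clog (mem_slitPlane_of_re_pos ha)).continuousWithinAt) hu.dt
    simp only [zero_add, pow_one]
    rw [hlog, hprim, ← mul_assoc, neg_mul_neg, Complex.I_mul_I, pow_zero, Nat.factorial_zero,
      Nat.cast_one, div_one]
    rfl
  | succ m ih =>
    have hm : (m + 1 : ℂ) ≠ 0 := Nat.cast_add_one_ne_zero m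
    have hstep := integral_deriv_comp_mul hq hqt hpos
      (fun a ha => hasDerivAt_inv_pow m (hne a ha))
      (continuousOn_const.mul ((continuousOn_pow _).inv₀ fun a ha => pow_ne_zero _ (hne a ha))) hu
    simp only [mul_assoc, integral_const_mul] at hstep
    rw [ih hu.dt, ← Function.iterate_succ_apply] at hstep
    refine mul_left_cancel₀ (neg_ne_zero.2 hm) (hstep.trans ?_)
    rw [Nat.factorial_succ]
    push_cast
    field_simp
    ring

end IntegrationByParts

section LimitExists

theorem dt_conj_gauge_mul (lam : Fin n → ℝ) (x y : Heis n) :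
    dt (fun y => conj (gauge lam (mul lam x y))) y = -Complex.I := by
  have hd : DifferentiableAt ℝ (fun y => conj (gauge lam (mul lam x y))) y :=
    ((contDiff_conj_gauge lam).comp (contDiff_mul_left lam x)).contDiffAt.differentiableAt (by simp)
  have hline (s : ℝ) : conj (gauge lam (mul lam x (y + s • ((0, 1) : Heis n)))) =
      conj (gauge lam (mul lam x y)) + s * -Complex.I := by
    simp only [mul, gauge, Prod.fst_add, Prod.snd_add, Prod.smul_fst, Prod.smul_snd, smul_zero,
      add_zero, smul_eq_mul, mul_one, map_add, map_mul, Complex.conj_I, Complex.conj_ofReal]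
    push_cast
    ring
  have hderiv : HasDerivAt (fun s : ℝ => conj (gauge lam (mul lam x y)) + s * -Complex.I)
      (-Complex.I) 0 := by
    simpa only [Complex.ofRealCLM_apply, Complex.ofReal_one, one_mul] using
      (Complex.ofRealCLM.hasDerivAt.mul_const (-Complex.I)).const_add _
  rw [dt, ← hd.lineDeriv_eq_fderiv, lineDeriv, funext hline, hderiv.deriv]

theorem integral_conj_szegoKernel_mul_test {lam : Fin n → ℝ} (hlam : ∀ j, 0 < lam j) {ε : ℝ}
    (hε : 0 < ε) (x : Heis n) {u : Heis n → ℂ} (hu : IsTest u) :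
    ∫ y, conj (szegoKernel lam ε (mul lam (-x) y)) * u y ∂heisVol n =
      -(Complex.I ^ n / n.factorial) *
        ∫ y, logPrimitive (conj (gauge lam (mul lam (-x) y)) + ε) * dt^[n + 2] u y ∂heisVol n := by
  have hd : Differentiable ℝ fun y => conj (gauge lam (mul lam (-x) y)) :=
    ((contDiff_conj_gauge lam).comp (contDiff_mul_left lam (-x))).differentiable (by simp)
  have hpos (y : Heis n) : 0 < (conj (gauge lam (mul lam (-x) y)) + ε).re := by
    rw [Complex.add_re, Complex.conj_re, Complex.ofReal_re]
    exact add_pos_of_nonneg_of_pos (gauge_re_nonneg hlam _) hε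
  have hdt (y : Heis n) :
      dt (fun y => conj (gauge lam (mul lam (-x) y)) + (ε : ℂ)) y = -Complex.I := by
    rw [← dt_conj_gauge_mul lam (-x) y, dt, dt, fderiv_add_const]
  simpa only [szegoKernel, map_inv₀, map_pow, map_add, Complex.conj_ofReal] using
    integral_inv_pow_comp_mul (hd.add_const _) hdt hpos n hu

theorem exists_continuous_extension {lam : Fin n → ℝ} (hlam : ∀ j, 0 < lam j) {u : Heis n → ℂ}
    (hu : IsTest u) :
    ∃ H : ℝ × Heis n → ℂ, Continuous H ∧ ∀ ε : ℝ, 0 < ε → ∀ x,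
      ∫ y, conj (szegoKernel lam ε (mul lam (-x) y)) * u y ∂heisVol n = H (ε, x) := by
  refine ⟨fun p => -(Complex.I ^ n / n.factorial) * ∫ y,
    logPrimitive (conj (gauge lam (mul lam (-p.2) y)) + (|p.1| : ℝ)) * dt^[n + 2] u y ∂heisVol n,
    continuous_const.mul ?_, fun ε hε x => by
      simp only [integral_conj_szegoKernel_mul_test hlam hε x hu, abs_of_pos hε]⟩
  have hv := hu.iterate_dt (n + 2)
  have hgauge : Continuous fun p : (ℝ × Heis n) × Heis n =>
      conj (gauge lam (mul lam (-p.1.2) p.2)) + ((|p.1.1| : ℝ) : ℂ) :=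
    ((contDiff_conj_gauge lam).continuous.comp ((continuous_mul lam).comp
      (by fun_prop : Continuous fun p : (ℝ × Heis n) × Heis n => (-p.1.2, p.2)))).add (by fun_prop)
  have hlog : Continuous fun p : (ℝ × Heis n) × Heis n =>
      logPrimitive (conj (gauge lam (mul lam (-p.1.2) p.2)) + ((|p.1.1| : ℝ) : ℂ)) := by
    refine continuousOn_logPrimitive.comp_continuous hgauge fun p => ?_
    rw [Set.mem_ofPred_eq, Complex.add_re, Complex.conj_re, Complex.ofReal_re]
    exact add_nonneg (gauge_re_nonneg hlam _) (abs_nonneg _)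
  rw [← continuousOn_univ]
  refine continuousOn_integral_of_compact_support hv.2
    (hlog.mul (hv.1.continuous.comp continuous_snd)).continuousOn fun p y _ hy => ?_
  rw [image_eq_zero_of_notMem_tsupport hy, mul_zero]

end LimitExists

/-! ### Approximate identities -/

section ApproximateIdentity

theorem integral_norm_mul_comp_mul_right_le (lam : Fin n → ℝ) {f ψ : Heis n → ℂ}
    (hf : MemLp f 2 (heisVol n)) (hψ : MemLp ψ 2 (heisVol n)) (v : Heis n) :
    ∫ y, ‖ψ y * f (mul lam y v)‖ ∂heisVol n ≤
      ∫ y, ‖ψ y‖ ^ 2 ∂heisVol n + ∫ y, ‖f y‖ ^ 2 ∂heisVol n := by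
  have hsq {g : Heis n → ℂ} (hg : MemLp g 2 (heisVol n)) :
      Integrable (fun y => ‖g y‖ ^ 2) (heisVol n) := (memLp_two_iff_integrable_sq_norm hg.1).1 hg
  have hfv : MemLp (fun y => f (mul lam y v)) 2 (heisVol n) :=
    hf.comp_measurePreserving (measurePreserving_mul_right lam v)
  rw [← integral_mul_right lam v fun y => ‖f y‖ ^ 2, ← integral_add (hsq hψ) (hsq hfv)]
  refine integral_mono (hψ.integrable_mul hfv).norm ((hsq hψ).add (hsq hfv)) fun y => ?_
  simp only [norm_mul]
  nlinarith [sq_nonneg (‖ψ y‖ - ‖f (mul lam y v)‖), sq_nonneg ‖ψ y‖,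
    sq_nonneg ‖f (mul lam y v)‖]

theorem tendsto_integral_mul_comp_mul_dil (lam : Fin n → ℝ) {f ψ : Heis n → ℂ}
    (hf : LocallyIntegrable f (heisVol n)) (hψ : Continuous ψ) (hψ' : HasCompactSupport ψ)
    (v : Heis n) :
    Tendsto (fun r : ℝ => ∫ y, ψ y * f (mul lam y (dil r v)) ∂heisVol n) (𝓝[>] 0)
      (𝓝 (∫ y, ψ y * f y ∂heisVol n)) := by
  have htranslate (r : ℝ) : ∫ y, ψ y * f (mul lam y (dil r v)) ∂heisVol n =
      ∫ y, f y * ψ (mul lam y (-dil r v)) ∂heisVol n := by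
    rw [← integral_mul_right lam (dil r v) fun y => f y * ψ (mul lam y (-dil r v))]
    simp only [mul_mul_neg, mul_comm]
  have hdil : Continuous fun r : ℝ => dil r v := continuous_dil.comp (Continuous.prodMk_left v)
  let k : Set (Heis n) := (fun p : ℝ × Heis n => mul lam p.2 (dil p.1 v)) ''
    (Set.Icc 0 1 ×ˢ tsupport ψ)
  have hk : IsCompact k := (isCompact_Icc.prod hψ').image
    ((continuous_mul lam).comp (continuous_snd.prodMk (hdil.comp continuous_fst)))
  have hcont : ContinuousOn (fun r : ℝ => ∫ y, f y * ψ (mul lam y (-dil r v)) ∂heisVol n)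
      (Set.Icc 0 1) := by
    refine continuousOn_integral_bilinear_of_locally_integrable_of_compact_support
      (ContinuousLinearMap.mul ℂ ℂ) (f := fun r y => ψ (mul lam y (-dil r v))) hk ?_ ?_
      (hf.integrableOn_isCompact hk)
    · exact (hψ.comp ((continuous_mul lam).comp
        (continuous_snd.prodMk (hdil.comp continuous_fst).neg))).continuousOn
    · refine fun r y hr hy => image_eq_zero_of_notMem_tsupport fun hmem => hy ?_
      exact ⟨(r, mul lam y (-dil r v)), ⟨hr, hmem⟩, by simpa using mul_mul_neg lam y (-dil r v)⟩
  have hlim := (hcont 0 (by simp)).tendsto.mono_left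
    (nhdsWithin_le_of_mem (Icc_mem_nhdsGT (zero_lt_one (α := ℝ))))
  simpa only [htranslate, dil_zero, neg_zero, mul_apply_zero, mul_comm] using hlim

variable (lam : Fin n → ℝ) {f ψ K : Heis n → ℂ} (hfm : StronglyMeasurable f)
  (hf : MemLp f 2 (heisVol n)) (hK : Integrable K (heisVol n))
include hfm hf hK

theorem integrable_prod_mul_comp_mul_dil_mul (hψ : MemLp ψ 2 (heisVol n)) (r : ℝ) :
    Integrable (fun p : Heis n × Heis n => ψ p.1 * f (mul lam p.1 (dil r p.2)) * K p.2)
      ((heisVol n).prod (heisVol n)) := by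
  have hmul : Continuous fun p : Heis n × Heis n => mul lam p.1 (dil r p.2) :=
    (continuous_mul lam).comp (continuous_fst.prodMk
      (continuous_dil.comp (continuous_const.prodMk continuous_snd)))
  have hm : AEStronglyMeasurable
      (fun p : Heis n × Heis n => ψ p.1 * f (mul lam p.1 (dil r p.2)) * K p.2)
      ((heisVol n).prod (heisVol n)) :=
    (hψ.1.comp_fst.mul (hfm.comp_measurable hmul.measurable).aestronglyMeasurable).mul
      hK.1.comp_snd
  refine (integrable_prod_iff' hm).2 ⟨ae_of_all _ fun v => ?_, ?_⟩
  · have hfv : MemLp (fun y => f (mul lam y (dil r v))) 2 (heisVol n) :=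
      hf.comp_measurePreserving (measurePreserving_mul_right lam (dil r v))
    exact (hψ.integrable_mul hfv).mul_const (K v)
  · refine (hK.norm.const_mul (∫ y, ‖ψ y‖ ^ 2 ∂heisVol n + ∫ y, ‖f y‖ ^ 2 ∂heisVol n)).mono'
      hm.norm.prod_swap.integral_prod_right' (ae_of_all _ fun v => ?_)
    rw [Real.norm_of_nonneg (integral_nonneg fun _ => norm_nonneg _)]
    simp only [norm_mul _ (K v), integral_mul_const]
    gcongr
    exact integral_norm_mul_comp_mul_right_le lam hf hψ (dil r v)

theorem tendsto_integral_mul_integral_comp_mul_dil_mul (hψ : Continuous ψ)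
    (hψ' : HasCompactSupport ψ) :
    Tendsto (fun r : ℝ => ∫ y, ψ y * ∫ v, f (mul lam y (dil r v)) * K v ∂heisVol n ∂heisVol n)
      (𝓝[>] 0) (𝓝 ((∫ y, ψ y * f y ∂heisVol n) * ∫ v, K v ∂heisVol n)) := by
  have hψ2 : MemLp ψ 2 (heisVol n) := hψ.memLp_of_hasCompactSupport hψ'
  have hprod := integrable_prod_mul_comp_mul_dil_mul lam hfm hf hK hψ2
  have hswap (r : ℝ) :
      ∫ y, ψ y * ∫ v, f (mul lam y (dil r v)) * K v ∂heisVol n ∂heisVol n =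
        ∫ v, (∫ y, ψ y * f (mul lam y (dil r v)) ∂heisVol n) * K v ∂heisVol n := by
    simp only [← integral_const_mul, ← integral_mul_const, ← mul_assoc]
    exact integral_integral_swap (hprod r)
  simp only [hswap]
  rw [← integral_const_mul]
  refine tendsto_integral_filter_of_dominated_convergence
    (fun v => (∫ y, ‖ψ y‖ ^ 2 ∂heisVol n + ∫ y, ‖f y‖ ^ 2 ∂heisVol n) * ‖K v‖)
    (Eventually.of_forall fun r => ?_) (Eventually.of_forall fun r => ae_of_all _ fun v => ?_)
    (hK.norm.const_mul _) (ae_of_all _ fun v => (tendsto_integral_mul_comp_mul_dil lam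
      (hf.locallyIntegrable one_le_two) hψ hψ' v).mul_const _)
  · simpa only [integral_mul_const] using (hprod r).integral_prod_right.aestronglyMeasurable
  · rw [norm_mul]
    gcongr
    exact (norm_integral_le_integral_norm _).trans
      (integral_norm_mul_comp_mul_right_le lam hf hψ2 (dil r v))

end ApproximateIdentity

section PoissonKernel

theorem poissonKernel_dil (lam : Fin n → ℝ) {r : ℝ} (hr : 0 < r) (v : Heis n) :
    poissonKernel lam (r ^ 2) (dil r v) = ((r ^ (2 * n + 2))⁻¹ : ℝ) • poissonKernel lam 1 v := by
  have hr' : (r : ℂ) ≠ 0 := Complex.ofReal_ne_zero.2 hr.ne'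
  have hg : gauge lam (dil r v) + ((r ^ 2 : ℝ) : ℂ) = r ^ 2 * (gauge lam v + 1) := by
    rw [gauge_dil, mul_add_one, Complex.ofReal_pow]
  have hcg : conj (gauge lam (dil r v)) + ((r ^ 2 : ℝ) : ℂ) =
      r ^ 2 * (conj (gauge lam v) + 1) := by
    rw [gauge_dil, map_mul, map_pow, Complex.conj_ofReal, mul_add_one, Complex.ofReal_pow]
  rw [poissonKernel, hcg, hg, poissonKernel, Complex.real_smul]
  push_cast
  rw [mul_pow, mul_inv, mul_inv, show (r : ℂ) ^ (2 * n + 2) = (r ^ 2) ^ (n + 1) by ring]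
  field_simp

theorem integral_mul_poissonKernel_sq (lam : Fin n → ℝ) (F : Heis n → ℂ) {r : ℝ} (hr : 0 < r) :
    ∫ v, F v * poissonKernel lam (r ^ 2) v ∂heisVol n =
      ∫ v, F (dil r v) * poissonKernel lam 1 v ∂heisVol n := by
  have h := integral_dil hr fun v => F v * poissonKernel lam (r ^ 2) v
  simp only [poissonKernel_dil lam hr, mul_smul_comm, integral_smul] at h
  exact (smul_right_injective ℂ (by positivity : (r ^ (2 * n + 2))⁻¹ ≠ 0) h).symm

theorem tendsto_integral_mul_integral_poissonKernel {lam : Fin n → ℝ} (hlam : ∀ j, 0 < lam j)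
    {f ψ : Heis n → ℂ} (hfm : StronglyMeasurable f) (hf : MemLp f 2 (heisVol n))
    (hψ : Continuous ψ) (hψ' : HasCompactSupport ψ) :
    Tendsto (fun r : ℝ => ∫ y, ψ y *
        ∫ v, f (mul lam y v) * poissonKernel lam (r ^ 2) v ∂heisVol n ∂heisVol n) (𝓝[>] 0)
      (𝓝 ((∫ y, ψ y * f y ∂heisVol n) *
        ((2 * Real.pi ^ (n + 1) / (n.factorial * ∏ j, lam j) : ℝ) : ℂ))) := by
  have h := tendsto_integral_mul_integral_comp_mul_dil_mul lam hfm hf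
    (integrable_poissonKernel hlam one_pos) hψ hψ'
  rw [integral_poissonKernel hlam one_pos] at h
  refine h.congr' ?_
  filter_upwards [self_mem_nhdsWithin] with r hr
  simp only [integral_mul_poissonKernel_sq lam _ (Set.mem_Ioi.1 hr)]

end PoissonKernel

/-! ### The Szegő projection of a test function -/

theorem ae_eq_of_forall_integral_test {g h : Heis n → ℂ} (hg : LocallyIntegrable g (heisVol n))
    (hh : LocallyIntegrable h (heisVol n))
    (H : ∀ ψ : Heis n → ℂ, IsTest ψ →
      ∫ y, ψ y * g y ∂heisVol n = ∫ y, ψ y * h y ∂heisVol n) : g =ᵐ[heisVol n] h := by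
  refine ae_eq_of_integral_contDiff_smul_eq hg hh fun χ hχ hχ' => ?_
  simpa only [Complex.real_smul] using H (fun x => (χ x : ℂ))
    ⟨Complex.ofRealCLM.contDiff.comp hχ, hχ'.comp_left (g := fun r : ℝ => (r : ℂ)) (by simp)⟩

theorem regularizedIntegral_phaseMinus {lam : Fin n → ℝ} (hlam : ∀ j, 0 < lam j) (ε : ℝ)
    (u : Heis n → ℂ) (x : Heis n) : regularizedIntegral (phaseMinus lam) ε u x =
      ∫ y, conj (szegoKernel lam ε (mul lam (-x) y)) * u y ∂heisVol n := by
  simp only [regularizedIntegral, phaseMinus_eq_gauge hlam, szegoKernel, one_div, map_inv₀,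
    map_pow, map_add, Complex.conj_ofReal]

theorem tendsto_integral_mul_apply_sq {H : ℝ × Heis n → ℂ} (hH : Continuous H) {ψ : Heis n → ℂ}
    (hψ : Continuous ψ) (hψ' : HasCompactSupport ψ) :
    Tendsto (fun r : ℝ => ∫ y, ψ y * H (r ^ 2, y) ∂heisVol n) (𝓝[>] 0)
      (𝓝 (∫ y, ψ y * H (0, y) ∂heisVol n)) := by
  have hcont : Continuous fun r : ℝ => ∫ y, ψ y * H (r ^ 2, y) ∂heisVol n := by
    rw [← continuousOn_univ]
    refine continuousOn_integral_of_compact_support hψ' (by fun_prop) fun r y _ hy => ?_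
    rw [image_eq_zero_of_notMem_tsupport hy, zero_mul]
  simpa using (hcont.tendsto 0).mono_left nhdsWithin_le_nhds

theorem smul_szegoProjection_ae_eq (hn : 1 ≤ n) {lam : Fin n → ℝ} (hlam : ∀ j, 0 < lam j)
    {u : Heis n → ℂ} (hu : IsTest u) {H : ℝ × Heis n → ℂ} (hH : Continuous H)
    (hHε : ∀ ε : ℝ, 0 < ε → ∀ x,
      ∫ y, conj (szegoKernel lam ε (mul lam (-x) y)) * u y ∂heisVol n = H (ε, x)) :
    (((2 * Real.pi ^ (n + 1) / (n.factorial * ∏ j, lam j) : ℝ) : ℂ) • szegoProjection lam)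
      (hu.memLp.toLp u) =ᵐ[heisVol n] fun x => H (0, x) := by
  set f := szegoProjection lam (hu.memLp.toLp u)
  set M : ℂ := ((2 * Real.pi ^ (n + 1) / (n.factorial * ∏ j, lam j) : ℝ) : ℂ)
  have hf := Lp.memLp f
  have hpoisson (r : ℝ) (hr : 0 < r) (y : Heis n) :
      ∫ v, f (mul lam y v) * poissonKernel lam (r ^ 2) v ∂heisVol n = H (r ^ 2, y) := by
    rw [← hHε _ (pow_pos hr 2), ← integral_conj_szegoKernel_mul hn hlam (pow_pos hr 2)]
    refine integral_congr_ae ?_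
    filter_upwards [hu.memLp.coeFn_toLp] with x hx
    rw [hx]
  refine (Lp.coeFn_smul M f).trans (ae_eq_of_forall_integral_test
    ((hf.const_smul M).locallyIntegrable one_le_two)
    (hH.comp (Continuous.prodMk_right 0)).locallyIntegrable fun ψ hψ => ?_)
  have hlim := tendsto_integral_mul_integral_poissonKernel hlam (Lp.stronglyMeasurable f) hf
    hψ.1.continuous hψ.2
  have hlim' : Tendsto (fun r : ℝ => ∫ y, ψ y * H (r ^ 2, y) ∂heisVol n) (𝓝[>] 0)
      (𝓝 ((∫ y, ψ y * f y ∂heisVol n) * M)) := by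
    refine hlim.congr' ?_
    filter_upwards [self_mem_nhdsWithin] with r hr
    simp only [hpoisson r hr]
  rw [← tendsto_nhds_unique hlim' (tendsto_integral_mul_apply_sq hH hψ.1.continuous hψ.2),
    ← integral_mul_const]
  simp only [Pi.smul_apply, smul_eq_mul, mul_assoc, mul_comm M]

theorem isL2Extension_smul_szegoProjection (hn : 1 ≤ n) {lam : Fin n → ℝ}
    (hlam : ∀ j, 0 < lam j) : IsL2Extension (phaseMinus lam)
      (((2 * Real.pi ^ (n + 1) / (n.factorial * ∏ j, lam j) : ℝ) : ℂ) • szegoProjection lam) := by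
  intro u hu
  obtain ⟨H, hH, hHε⟩ := exists_continuous_extension hlam hu
  refine ⟨fun x => H (0, x), fun x => ?_, smul_szegoProjection_ae_eq hn hlam hu hH hHε⟩
  have hlim : Tendsto (fun ε : ℝ => H (ε, x)) (𝓝[>] 0) (𝓝 (H (0, x))) :=
    ((hH.comp (Continuous.prodMk_left x)).tendsto 0).mono_left nhdsWithin_le_nhds
  refine hlim.congr' ?_
  filter_upwards [self_mem_nhdsWithin] with ε hε
  rw [regularizedIntegral_phaseMinus hlam, hHε ε hε x]

theorem IsL2Extension.eq {φ : Heis n → Heis n → ℂ} {I J : L2Fun n →L[ℂ] L2Fun n}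
    (hI : IsL2Extension φ I) (hJ : IsL2Extension φ J) : I = J := by
  refine DFunLike.coe_injective (Continuous.ext_on (Lp.dense_hasCompactSupport_contDiff (F := ℂ)
    (μ := heisVol n) (p := 2) (by norm_num)) I.continuous J.continuous ?_)
  rintro f ⟨u, hfu, hu', hu''⟩
  have hu : IsTest u := ⟨hu'', hu'⟩
  obtain ⟨g, hg, hIg⟩ := hI u hu
  obtain ⟨g', hg', hJg⟩ := hJ u hu
  obtain rfl : g = g' := funext fun x => tendsto_nhds_unique (hg x) (hg' x)
  rw [show f = hu.memLp.toLp u from Lp.ext (hfu.trans hu.memLp.coeFn_toLp.symm)]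
  exact Lp.ext (hIg.trans hJg.symm)

end Heisenberg

end

theorem theorem1p2 (n : ℕ) (hn : 1 ≤ n) (lam : Fin n → ℝ) (hlam : ∀ j, 0 < lam j) :
    (∃! I : Heisenberg.L2Fun n →L[ℂ] Heisenberg.L2Fun n,
        Heisenberg.IsL2Extension (Heisenberg.phaseMinus lam) I) ∧
      ∀ I : Heisenberg.L2Fun n →L[ℂ] Heisenberg.L2Fun n,
        Heisenberg.IsL2Extension (Heisenberg.phaseMinus lam) I →
          Heisenberg.szegoProjection lam =
            (((∏ j, |lam j|) / (2 * Real.pi ^ (n + 1)) * (n.factorial : ℝ) : ℝ) : ℂ) • I := by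
  have hS := Heisenberg.isL2Extension_smul_szegoProjection hn hlam
  refine ⟨⟨_, hS, fun J hJ => hJ.eq hS⟩, fun I hI => ?_⟩
  have hprod := Finset.prod_pos fun j (_ : j ∈ Finset.univ) => hlam j
  have hconst : (∏ j, |lam j|) / (2 * Real.pi ^ (n + 1)) * (n.factorial : ℝ) *
      (2 * Real.pi ^ (n + 1) / (n.factorial * ∏ j, lam j)) = 1 := by
    simp only [abs_of_pos (hlam _)]
    field_simp
  rw [hI.eq hS, smul_smul, ← Complex.ofReal_mul, hconst, Complex.ofReal_one, one_smul]
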